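/- For $U\subseteq\mathbb R^d$ let $C(U)$ be the space of nonnegative continuous functions on $U$ with the topology of uniform convergence on compact sets. Let $F$ be a random element of $C(\mathbb R^d)$ with law $\mathbb P_F$ such that $\mathbb E\int_{\mathbb R^d}F(t)\,dt=1$; such that, for some $\lambda>0$, almost surely $F(0)=\lambda$ and $F(t)<\lambda$ for all $t\neq 0$; and such that $\int_{\mathbb R^d}\mathbb E\{\max_{t_0\in K'}F(t_0-t)\}\,dt<\infty$ for every compact $K'\subset\mathbb R^d$. Let $M(t)=\max_{i\in\mathbb N}U_iF_i(t-T_i)$, $t\in\mathbb R^d$, be the mixed moving maxima process with shape function $F$, where $\sum_i\delta_{(U_i,T_i,F_i)}$ is a Poisson point process on $(0,\infty)\times\mathbb R^d\times C(\mathbb R^d)$ with intensity $u^{-2}du\,dt\,\mathbb P_F(df)$. Let $\eta$ be a strictly positive random element of $C(\mathbb R^d)$ in the max-domain of attraction of $M$ in the sense that $\frac1n\max_{i\le n}\eta_i\to M$ weakly in $C(\mathbb R^d)$ as $n\to\infty$, where $\eta_1,\eta_2,\dots$ are independent copies of $\eta$. Let $Q,K\subset\mathbb R^d$ be compact, where $Q$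 has positive Lebesgue measure and its boundary $\partial Q$ is a Lebesgue null set. For $f\in C(Q)$ let $\tau_Q(f)$ be the lexicographically smallest point of $\operatorname{argmax}_{t\in Q}f(t)$. Then for every Borel set $B\subset C(K)$ with $\mathbb P\{F|_K/\lambda\in\partial B\}=0$ and every real sequence $a(n)\to\infty$, $$\lim_{L\nearrow\mathbb R^d}\ \limsup_{n\to\infty}\ \mathbb P\Big\{\tfrac{\eta(\tau_Q(\eta|_Q)+\cdot)}{\eta(\tau_Q(\eta|_Q))}\Big|_K\in B\ \Big|\ \max_{t\in Q}\eta(t)=\max_{t\in Q\oplus L}\eta(t),\ \max_{t\in Q}\eta(t)\ge a(n)\Big\}=\mathbb P\big\{F|_K/\lambda\in B\big\},$$ and the same holds with $\limsup_{n\to\infty}$ replaced by $\liminf_{n\to\infty}$. Here $Q\oplus L=\{q+l: q\in Q,\ l\in L\}$, and the limit $L\nearrow\mathbb R^d$ is taken along an arbitrary increasing sequence $L_1\subseteq L_2\subseteq\cdots$ of compact sets containing $0$ with $\bigcup_jL_j=\mathbb R^d$. -/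

import Mathlib

open MeasureTheory ProbabilityTheory Filter Topology Set
open scoped NNReal ENNReal Pointwise

/-- Spaces of continuous functions carry the topology of uniform convergence on compact sets
(Mathlib's compact-open topology) and its Borel σ-algebra. -/
instance ContinuousMap.instMeasurableSpaceBorel {X Y : Type*} [TopologicalSpace X]
    [TopologicalSpace Y] : MeasurableSpace C(X, Y) := borel _

instance ContinuousMap.instBorelSpaceBorel {X Y : Type*} [TopologicalSpace X]
    [TopologicalSpace Y] : BorelSpace C(X, Y) := ⟨rfl⟩

/-- The space `C(U)` of nonnegative continuous functions on `U`. -/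
abbrev NNCont (U : Type*) [TopologicalSpace U] : Type _ := C(U, ℝ≥0)

namespace M3

/-- The counting measure `∑ i, δ_{X i ω}` of a random sequence of points. -/
noncomputable def pointMeasure {Ω S : Type*} [MeasurableSpace S] (X : ℕ → Ω → S) (ω : Ω) :
    Measure S :=
  Measure.sum fun i => Measure.dirac (X i ω)

/-- `∑ i, δ_{X i}` is a Poisson point process with intensity measure `ν`: the number of points in
a measurable set of finite intensity is Poisson distributed with that intensity as parameter, and
the numbers of points in pairwise disjoint measurable sets are independent. -/
structure IsPoissonPointProcess {Ω S : Type*} [MeasurableSpace Ω] [MeasurableSpace S]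
    (X : ℕ → Ω → S) (ν : Measure S) (P : Measure Ω) : Prop where
  measurable : ∀ i, Measurable (X i)
  map_count : ∀ A : Set S, MeasurableSet A → ν A ≠ ∞ →
    P.map (fun ω => pointMeasure X ω A) =
      (poissonMeasure (ν A).toNNReal).map (fun k : ℕ => (k : ℝ≥0∞))
  iIndepFun_count : ∀ (k : ℕ) (A : Fin k → Set S), (∀ j, MeasurableSet (A j)) →
    Pairwise (fun j j' => Disjoint (A j) (A j')) →
    iIndepFun (fun (j : Fin k) (ω : Ω) => pointMeasure X ω (A j)) P

/-- The measure `u⁻² du` on `(0, ∞)`. -/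
noncomputable def frechetIntensity : Measure ℝ :=
  (volume.restrict (Ioi (0 : ℝ))).withDensity fun u => ENNReal.ofReal (u ^ 2)⁻¹

variable {d : ℕ}

/-- `M` is a mixed moving maxima process with shape function `F`, that is
`M(t) = max_i U_i F_i(t - T_i)`, where `∑ i, δ_{(U_i, T_i, F_i)}` is a Poisson point process on
`(0, ∞) × ℝ^d × C(ℝ^d)` with intensity `u⁻² du × dt × P_F(df)`. -/
def IsMixedMovingMaxima {Ω Ω' : Type*} [MeasurableSpace Ω] [MeasurableSpace Ω']
    (M : Ω → NNCont (EuclideanSpace ℝ (Fin d))) (P : Measure Ω)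
    (F : Ω' → NNCont (EuclideanSpace ℝ (Fin d))) (P' : Measure Ω') : Prop :=
  ∃ X : ℕ → Ω → ℝ × EuclideanSpace ℝ (Fin d) × NNCont (EuclideanSpace ℝ (Fin d)),
    IsPoissonPointProcess X (frechetIntensity.prod (volume.prod (P'.map F))) P ∧
    ∀ᵐ ω ∂P, ∀ t : EuclideanSpace ℝ (Fin d),
      (M ω t : ℝ≥0∞) =
        ⨆ i, ENNReal.ofReal (X i ω).1 * ((X i ω).2.2 (t - (X i ω).2.1) : ℝ≥0∞)

/-- The function `(1 / n) max_{i ≤ n} f_i`. -/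
noncomputable def scaledMax {U : Type*} [TopologicalSpace U] (n : ℕ) (f : Fin n → NNCont U) :
    NNCont U where
  toFun t := (Finset.univ.sup fun i => f i t) / (n : ℝ≥0)
  continuous_toFun :=
    (Continuous.finset_sup_apply fun i _ => (f i).continuous).div_const _

/-- `η` is in the max-domain of attraction of `M`, with norming functions `c_n = 1 / n` and
`b_n = 0`, in the sense of weak convergence in `C(U)`: if `η_1, η_2, …` are independent copies of
`η`, then `(1 / n) max_{i ≤ n} η_i` converges in distribution to `M`. The independent copies
`η_1, …, η_n` are realised on the product space `Ω^n` as `η_i(ω) = η(ω_i)`. -/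
def InMaxDomainOfAttraction {U Ω Ω' : Type*} [TopologicalSpace U]
    [MeasurableSpace Ω] [MeasurableSpace Ω']
    (η : Ω → NNCont U) (P : Measure Ω) [IsProbabilityMeasure P]
    (M : Ω' → NNCont U) (P' : Measure Ω') [IsProbabilityMeasure P'] : Prop :=
  TendstoInDistribution (fun (n : ℕ) (ω : Fin n → Ω) => scaledMax n fun i => η (ω i)) atTop M
    (fun n => Measure.pi fun _ : Fin n => P) P'

/-- The set of points at which `f` attains its maximum over `Q`. -/
def argmaxOn (Q : Set (EuclideanSpace ℝ (Fin d))) (f : EuclideanSpace ℝ (Fin d) → ℝ≥0) :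
    Set (EuclideanSpace ℝ (Fin d)) :=
  {t | t ∈ Q ∧ ∀ s ∈ Q, f s ≤ f t}

open Classical in
/-- `τ_Q(f)`, the lexicographically smallest element of `argmax_{t ∈ Q} f(t)`. (It exists if `Q` is
compact and nonempty and `f` is continuous; the value `0` is used otherwise.) -/
noncomputable def tau (Q : Set (EuclideanSpace ℝ (Fin d)))
    (f : EuclideanSpace ℝ (Fin d) → ℝ≥0) : EuclideanSpace ℝ (Fin d) :=
  if h : ∃ t ∈ argmaxOn Q f, ∀ s ∈ argmaxOn Q f, toLex (fun i => t i) ≤ toLex (fun i => s i)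
  then h.choose else 0

/-- The function `t ↦ f (s + t) / c` in `C(K)`. -/
noncomputable def window (K : Set (EuclideanSpace ℝ (Fin d)))
    (f : NNCont (EuclideanSpace ℝ (Fin d))) (s : EuclideanSpace ℝ (Fin d)) (c : ℝ≥0) :
    NNCont K where
  toFun t := f (s + t) / c
  continuous_toFun := by fun_prop

/-- The event `{max_Q η = max_{Q ⊕ L} η, max_Q η ≥ a}`. -/
def peakEvent {Ω : Type*} (η : Ω → NNCont (EuclideanSpace ℝ (Fin d)))
    (Q L : Set (EuclideanSpace ℝ (Fin d))) (a : ℝ) : Set Ω :=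
  {ω | sSup (η ω '' Q) = sSup (η ω '' (Q + L)) ∧ a ≤ (sSup (η ω '' Q) : ℝ≥0)}

/-- The event `{η(τ_Q(η|_Q) + ·) / η(τ_Q(η|_Q)) ∈ B}` for `B ⊆ C(K)`. -/
def shapeEvent {Ω : Type*} (η : Ω → NNCont (EuclideanSpace ℝ (Fin d)))
    (Q K : Set (EuclideanSpace ℝ (Fin d))) (B : Set (NNCont K)) : Set Ω :=
  {ω | window K (η ω) (tau Q (η ω)) (η ω (tau Q (η ω))) ∈ B}

end M3

/-! The argument is the principle of a single big jump. On a compact `C`, the limit `M` is the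
pointwise supremum of a Poisson process whose points are the functions `u f(· - t)`; their intensity
on `C(C)` is `exponentMeasure`, which is homogeneous of order -1 and finite away from 0. The
max-domain hypothesis makes `a * P(η/a ∈ ·)` comparable to this measure for large `a`. Only two
one-sided facts are needed: `eventually_mul_real_le`, an upper bound for closed sets away from 0,
and `eventually_le_mul_real`, a lower bound for the total tail of the supremum.

Both come from comparing `n` independent copies with the Poisson process at a high level `x n`. One
exceedance has probability of order `1/x`, two have order `1/x^2`, so each maximum is essentially
one copy, or one Poisson point (`mul_real_mem_le`, `IsPoissonSup.real_mem_le`).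

It remains to compute exponent measures. Since `f` has its strict maximum `λ` at 0, the function `u
f(· - t)` has its unique maximum at `t`, and its normalized shape around `t` does not depend on `u`
or `t`. A peak in `Q` with shape in `B` therefore forces `t ∈ Q`, `u λ ≥ 1` and `f/λ ∈ closure B`,
which has mass `λ |Q| P(F/λ ∈ closure B)`, unless `t` lies outside `Q ⊕ L` while the function still
reaches 1 on `Q` (`exponentMeasure_peakShapes_le`). These remote points have finite mass decreasing
to 0 as `L` grows (`tendsto_remoteExceedances`). Peaks alone have asymptotic mass at least `λ |Q|`:
from the total tail over `Q ⊕ L` one subtracts the off-peak part, whose closure misses almost every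
point with `t` interior to `Q` and `u λ ≥ 1` (`exponentMeasure_offPeakShapes_add_le`).

The quotient bounds the conditional probability above, up to the remote mass over `λ |Q|`. Applying
this to `B` and to its complement gives both directions, because `frontier B` is null for the law of
`F/λ`. -/

namespace M3

/-! ### The supremum norm on nonnegative functions, written as the distance to 0. -/

section SupDistance

variable {T : Type*} [TopologicalSpace T] [CompactSpace T]

lemma dist_zero_le_iff {f : C(T, ℝ≥0)} {r : ℝ} (hr : 0 ≤ r) :
    dist f 0 ≤ r ↔ ∀ t, (f t : ℝ) ≤ r := by
  rw [ContinuousMap.dist_le hr]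
  refine forall_congr' fun t => ?_
  simp [NNReal.dist_eq]

lemma apply_le_dist_zero (f : C(T, ℝ≥0)) (t : T) : (f t : ℝ) ≤ dist f 0 :=
  (dist_zero_le_iff dist_nonneg).1 le_rfl t

lemma lt_dist_zero_iff {f : C(T, ℝ≥0)} {r : ℝ} (hr : 0 ≤ r) :
    r < dist f 0 ↔ ∃ t, r < (f t : ℝ) := by
  rw [← not_le, dist_zero_le_iff hr]
  push Not
  rfl

lemma dist_smul_smul_le (c : ℝ≥0) (f g : C(T, ℝ≥0)) :
    dist (c • f) (c • g) ≤ c * dist f g := by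
  rw [ContinuousMap.dist_le (by positivity)]
  intro t
  have h := ContinuousMap.dist_apply_le_dist (f := f) (g := g) t
  rw [NNReal.dist_eq] at h ⊢
  simp only [ContinuousMap.smul_apply, smul_eq_mul, NNReal.coe_mul]
  rw [← mul_sub, abs_mul, NNReal.abs_eq]
  exact mul_le_mul_of_nonneg_left h c.2

lemma dist_smul_zero (c : ℝ≥0) (f : C(T, ℝ≥0)) : dist (c • f) 0 = c * dist f 0 := by
  have key : ∀ (c : ℝ≥0) (f : C(T, ℝ≥0)), dist (c • f) 0 ≤ c * dist f 0 := fun c f => by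
    simpa using dist_smul_smul_le c f 0
  rcases eq_or_ne c 0 with rfl | hc
  · simp
  · refine (key c f).antisymm ?_
    have h := key c⁻¹ (c • f)
    rw [inv_smul_smul₀ hc, NNReal.coe_inv, inv_mul_eq_div, le_div_iff₀ (by positivity)] at h
    linarith

/-- Deterministic form of the single big jump: taking the maximum of `g` with functions bounded by
`e` moves `g` by at most `e`. It serves both the independent copies and the Poisson points. -/
lemma dist_le_of_le_max {f g : C(T, ℝ≥0)} {e : ℝ} (he : 0 ≤ e) (h₁ : ∀ t, g t ≤ f t)
    (h₂ : ∀ t, (f t : ℝ) ≤ max (g t : ℝ) e) : dist f g ≤ e := by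
  rw [ContinuousMap.dist_le he]
  intro t
  have h₁' : (g t : ℝ) ≤ f t := h₁ t
  rw [NNReal.dist_eq, abs_of_nonneg (by linarith)]
  rcases max_cases (g t : ℝ) e with h | h <;> linarith [h₂ t, (g t).2, show 0 ≤ (g t : ℝ) from (g t).2]

end SupDistance

/-! ### Homogeneous measures and suprema of Poisson processes. -/

/-- The measure `μ` is homogeneous of order `-1`, and the radial part of it is `c u⁻² du`. -/
structure IsHomogeneousMeasure {T : Type*} [TopologicalSpace T] [CompactSpace T]
    (μ : Measure C(T, ℝ≥0)) (c : ℝ) : Prop where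
  const_nonneg : 0 ≤ c
  le_dist : ∀ y : ℝ, 0 < y → μ {g | y ≤ dist g 0} = ENNReal.ofReal (c / y)
  lt_dist : ∀ y : ℝ, 0 < y → μ {g | y < dist g 0} = ENNReal.ofReal (c / y)
  scaling : ∀ (x : ℝ≥0) (A : Set C(T, ℝ≥0)), 0 < x → MeasurableSet A →
    μ {g | x⁻¹ • g ∈ A} = (x⁻¹ : ℝ≥0) * μ A

/-- `Z` is the pointwise supremum of the random functions `Y i`, whose counts behave like those
of a Poisson point process with intensity `μ`. -/
structure IsPoissonSup {T Ω : Type*} [TopologicalSpace T] [CompactSpace T] [MeasurableSpace Ω]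
    (Z : Ω → C(T, ℝ≥0)) (Y : ℕ → Ω → C(T, ℝ≥0)) (μ : Measure C(T, ℝ≥0)) (P : Measure Ω) :
    Prop where
  exists_mem : ∀ A, MeasurableSet A → μ A ≠ ∞ →
    P.real {ω | ∃ i, Y i ω ∈ A} = 1 - Real.exp (-μ.real A)
  two_mem : ∀ A, MeasurableSet A → μ A ≠ ∞ →
    P.real {ω | ∃ i k, i ≠ k ∧ Y i ω ∈ A ∧ Y k ω ∈ A} ≤ μ.real A ^ 2
  eq_iSup : ∀ᵐ ω ∂P, ∀ t, (Z ω t : ℝ≥0∞) = ⨆ i, (Y i ω t : ℝ≥0∞)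

section

variable {T : Type*} [TopologicalSpace T] [CompactSpace T]

lemma IsHomogeneousMeasure.measure_ne_top {μ : Measure C(T, ℝ≥0)} {c : ℝ}
    (h : IsHomogeneousMeasure μ c) {A : Set C(T, ℝ≥0)} {y : ℝ} (hy : 0 < y)
    (hA : ∀ g ∈ A, y ≤ dist g 0) : μ A ≠ ∞ := by
  have hsub : A ⊆ {g | y ≤ dist g 0} := fun g hg => hA g hg
  refine ne_top_of_le_ne_top ?_ (measure_mono hsub)
  rw [h.le_dist y hy]
  exact ENNReal.ofReal_ne_top

lemma IsHomogeneousMeasure.real_le_dist {μ : Measure C(T, ℝ≥0)} {c : ℝ}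
    (h : IsHomogeneousMeasure μ c) {y : ℝ} (hy : 0 < y) : μ.real {g | y ≤ dist g 0} = c / y := by
  rw [measureReal_def, h.le_dist y hy, ENNReal.toReal_ofReal]
  exact div_nonneg h.const_nonneg hy.le

lemma IsHomogeneousMeasure.real_lt_dist {μ : Measure C(T, ℝ≥0)} {c : ℝ}
    (h : IsHomogeneousMeasure μ c) {y : ℝ} (hy : 0 < y) : μ.real {g | y < dist g 0} = c / y := by
  rw [measureReal_def, h.lt_dist y hy, ENNReal.toReal_ofReal]
  exact div_nonneg h.const_nonneg hy.le

lemma continuous_dist_zero : Continuous fun g : C(T, ℝ≥0) => dist g 0 :=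
  continuous_id.dist continuous_const

lemma measurableSet_le_dist_zero (y : ℝ) : MeasurableSet {g : C(T, ℝ≥0) | y ≤ dist g 0} :=
  (isClosed_le continuous_const continuous_dist_zero).measurableSet

lemma measurableSet_lt_dist_zero (y : ℝ) : MeasurableSet {g : C(T, ℝ≥0) | y < dist g 0} :=
  (isOpen_lt continuous_const continuous_dist_zero).measurableSet

variable {Ω' : Type*} [MeasurableSpace Ω'] {P' : Measure Ω'} [IsProbabilityMeasure P']
  {Z : Ω' → C(T, ℝ≥0)} {Y : ℕ → Ω' → C(T, ℝ≥0)} {μ : Measure C(T, ℝ≥0)} {c : ℝ}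

/-- The supremum of a Poisson process exceeds a level only if one of its points does. -/
lemma IsPoissonSup.real_le_dist_le (h : IsPoissonSup Z Y μ P') (hμ : IsHomogeneousMeasure μ c)
    {e : ℝ} (he : 0 < e) : P'.real {ω | e ≤ dist (Z ω) 0} ≤ 2 * c / e := by
  -- Halving the level turns the weak inequality into a strict one, which a supremum passes on to
  -- one of its terms. The lost factor 2 is harmless.
  have he2 : 0 < e / 2 := by positivity
  have hfin : μ {g | e / 2 < dist g 0} ≠ ∞ := hμ.measure_ne_top he2 fun g hg => le_of_lt hg
  calc P'.real {ω | e ≤ dist (Z ω) 0}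
      ≤ P'.real {ω | ∃ i, Y i ω ∈ {g | e / 2 < dist g 0}} := by
        refine ENNReal.toReal_mono (measure_ne_top _ _) (measure_mono_ae ?_)
        filter_upwards [h.eq_iSup] with ω hω hZ
        have hZ : e ≤ dist (Z ω) 0 := hZ
        obtain ⟨t, ht⟩ := (lt_dist_zero_iff he2.le).1 (show e / 2 < dist (Z ω) 0 by linarith)
        have : ENNReal.ofReal (e / 2) < ⨆ i, (Y i ω t : ℝ≥0∞) := by
          rw [← hω t, ENNReal.ofReal_lt_coe_iff (by positivity)]
          exact ht
        obtain ⟨i, hi⟩ := lt_iSup_iff.1 this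
        rw [ENNReal.ofReal_lt_coe_iff (by positivity)] at hi
        exact ⟨i, (lt_dist_zero_iff he2.le).2 ⟨t, hi⟩⟩
    _ = 1 - Real.exp (-μ.real {g | e / 2 < dist g 0}) :=
        h.exists_mem _ (measurableSet_lt_dist_zero _) hfin
    _ ≤ μ.real {g | e / 2 < dist g 0} := by
        linarith [Real.add_one_le_exp (-μ.real {g : C(T, ℝ≥0) | e / 2 < dist g 0})]
    _ = 2 * c / e := by rw [hμ.real_lt_dist he2]; field_simp

/-- Above a high level, the supremum of a Poisson process is close to one of its points, unless
two points are large. -/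
lemma IsPoissonSup.real_mem_le (h : IsPoissonSup Z Y μ P') (hμ : IsHomogeneousMeasure μ c)
    {e : ℝ} (he : 0 < e) {G G' : Set C(T, ℝ≥0)} (hG : ∀ g ∈ G, e < dist g 0)
    (hGG' : ∀ g ∈ G, ∀ f, dist g f ≤ e → f ∈ G') (hG' : MeasurableSet G') (hfin : μ G' ≠ ∞) :
    P'.real {ω | Z ω ∈ G} ≤ μ.real G' + (c / e) ^ 2 := by
  set S : Set C(T, ℝ≥0) := {g | e < dist g 0} with hS
  have hfin' : μ S ≠ ∞ := hμ.measure_ne_top he fun g hg => le_of_lt hg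
  calc P'.real {ω | Z ω ∈ G}
      ≤ P'.real ({ω | ∃ i, Y i ω ∈ G'} ∪ {ω | ∃ i k, i ≠ k ∧ Y i ω ∈ S ∧ Y k ω ∈ S}) := by
        refine ENNReal.toReal_mono (measure_ne_top _ _) (measure_mono_ae ?_)
        filter_upwards [h.eq_iSup] with ω hω hZ
        have hZ : Z ω ∈ G := hZ
        by_cases h2 : ∃ i k, i ≠ k ∧ Y i ω ∈ S ∧ Y k ω ∈ S
        · exact Or.inr h2
        left
        obtain ⟨t, ht⟩ := (lt_dist_zero_iff he.le).1 (hG _ hZ)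
        have : ENNReal.ofReal e < ⨆ i, (Y i ω t : ℝ≥0∞) := by
          rw [← hω t, ENNReal.ofReal_lt_coe_iff he.le]
          exact ht
        obtain ⟨i, hi⟩ := lt_iSup_iff.1 this
        rw [ENNReal.ofReal_lt_coe_iff he.le] at hi
        have hiS : Y i ω ∈ S := (lt_dist_zero_iff he.le).2 ⟨t, hi⟩
        refine ⟨i, hGG' _ hZ _ (dist_le_of_le_max he.le (fun s => ?_) fun s => ?_)⟩
        · have : (Y i ω s : ℝ≥0∞) ≤ Z ω s := by
            rw [hω s]
            exact le_iSup (fun i => (Y i ω s : ℝ≥0∞)) i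
          exact_mod_cast this
        · have : (Z ω s : ℝ≥0∞) ≤ max (Y i ω s : ℝ≥0∞) (ENNReal.ofReal e) := by
            rw [hω s]
            refine iSup_le fun k => ?_
            by_cases hk : k = i
            · exact hk ▸ le_max_left _ _
            · refine le_max_of_le_right ?_
              by_contra hlt
              rw [not_le, ENNReal.ofReal_lt_coe_iff he.le] at hlt
              exact h2 ⟨k, i, hk, (lt_dist_zero_iff he.le).2 ⟨s, hlt⟩, hiS⟩
          have h3 : Z ω s ≤ max (Y i ω s) e.toNNReal := by
            rw [ENNReal.ofReal] at this
            exact_mod_cast this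
          have h4 : ((Z ω s : ℝ≥0) : ℝ) ≤ (max (Y i ω s) e.toNNReal : ℝ≥0) := h3
          rwa [NNReal.coe_max, Real.coe_toNNReal _ he.le] at h4
    _ ≤ P'.real {ω | ∃ i, Y i ω ∈ G'} + P'.real {ω | ∃ i k, i ≠ k ∧ Y i ω ∈ S ∧ Y k ω ∈ S} :=
        measureReal_union_le _ _
    _ ≤ μ.real G' + (c / e) ^ 2 := by
        rw [h.exists_mem _ hG' hfin]
        have h1 := Real.add_one_le_exp (-μ.real G')
        have h2 := h.two_mem S (measurableSet_lt_dist_zero _) hfin'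
        rw [hS, hμ.real_lt_dist he] at h2
        linarith

/-- A lower bound for the tail of the supremum of a Poisson process. -/
lemma IsPoissonSup.le_real_lt_dist (h : IsPoissonSup Z Y μ P') (hμ : IsHomogeneousMeasure μ c)
    {e : ℝ} (he : 0 < e) : 1 - Real.exp (-(c / e)) ≤ P'.real {ω | e < dist (Z ω) 0} := by
  have hfin : μ {g | e < dist g 0} ≠ ∞ := hμ.measure_ne_top he fun g hg => le_of_lt hg
  have h1 := h.exists_mem _ (measurableSet_lt_dist_zero e) hfin
  rw [hμ.real_lt_dist he] at h1
  rw [← h1]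
  refine ENNReal.toReal_mono (measure_ne_top _ _) (measure_mono_ae ?_)
  filter_upwards [h.eq_iSup] with ω hω hY
  obtain ⟨i, hi⟩ := hY
  obtain ⟨t, ht⟩ := (lt_dist_zero_iff he.le).1 hi
  refine (lt_dist_zero_iff he.le).2 ⟨t, ht.trans_le ?_⟩
  have : (Y i ω t : ℝ≥0∞) ≤ Z ω t := by
    rw [hω t]
    exact le_iSup (fun i => (Y i ω t : ℝ≥0∞)) i
  exact_mod_cast this

end

/-! ### Maxima of independent copies. -/

section ProductSpace

lemma scaledMax_apply_le_iff {T : Type*} [TopologicalSpace T] {n : ℕ} (hn : 0 < n)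
    (f : Fin n → C(T, ℝ≥0)) (t : T) (b : ℝ≥0) :
    scaledMax n f t ≤ b ↔ ∀ i, ((n : ℝ≥0)⁻¹ • f i) t ≤ b := by
  have hn' : (0 : ℝ≥0) < n := by exact_mod_cast hn
  change (Finset.univ.sup fun i => f i t) / (n : ℝ≥0) ≤ b ↔ _
  rw [div_le_iff₀ hn', Finset.sup_le_iff]
  simp [inv_mul_le_iff₀ hn', mul_comm]

variable {T : Type*} [TopologicalSpace T] [CompactSpace T] {Ω : Type*} [MeasurableSpace Ω]
  {P : Measure Ω} [IsProbabilityMeasure P] {ζ : Ω → C(T, ℝ≥0)}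

lemma dist_scaledMax_zero_le_iff {n : ℕ} (hn : 0 < n) (f : Fin n → C(T, ℝ≥0)) {e : ℝ}
    (he : 0 ≤ e) : dist (scaledMax n f) 0 ≤ e ↔ ∀ i, dist ((n : ℝ≥0)⁻¹ • f i) 0 ≤ e := by
  lift e to ℝ≥0 using he
  simp only [dist_zero_le_iff e.coe_nonneg, NNReal.coe_le_coe, scaledMax_apply_le_iff hn]
  exact forall_comm

/-- If exactly one of `n` independent copies is large, then the maximum is close to that copy. -/
lemma mul_real_mem_le (hζ : Measurable ζ) {n : ℕ} (hn : 0 < n) {e : ℝ} (he : 0 ≤ e)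
    {A G : Set C(T, ℝ≥0)} (hA : MeasurableSet A) (hAe : ∀ g ∈ A, e < dist g 0)
    (hAG : ∀ g ∈ A, ∀ f, dist f g ≤ e → f ∈ G) :
    n * P.real {ω | (n : ℝ≥0)⁻¹ • ζ ω ∈ A} *
        (Measure.pi fun _ : Fin n => P).real {ω | dist (scaledMax n fun i => ζ (ω i)) 0 ≤ e} ≤
      (Measure.pi fun _ : Fin n => P).real {ω | scaledMax n (fun i => ζ (ω i)) ∈ G} := by
  classical
  set Pn := Measure.pi fun _ : Fin n => P
  set U : Set Ω := {ω | (n : ℝ≥0)⁻¹ • ζ ω ∈ A} with hU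
  set V : Set Ω := {ω | dist ((n : ℝ≥0)⁻¹ • ζ ω) 0 ≤ e} with hV
  have hm : Measurable fun ω => (n : ℝ≥0)⁻¹ • ζ ω :=
    (continuous_const_smul _).measurable.comp hζ
  have hUm : MeasurableSet U := hm hA
  have hVm : MeasurableSet V :=
    hm (isClosed_le continuous_dist_zero continuous_const).measurableSet
  have hUV : ∀ ω ∈ U, ω ∉ V := fun ω h1 h2 => (hAe _ h1).not_ge h2
  -- Copy `i` is large and all others are small. These boxes are disjoint because `U` and `V` are,
  -- so their probabilities add up instead of merely being bounded by a union.
  let J : Fin n → Set (Fin n → Ω) := fun i => univ.pi fun k => if k = i then U else V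
  have hJm : ∀ i, MeasurableSet (J i) := fun i => MeasurableSet.univ_pi fun k => by
    split_ifs <;> assumption
  have hJP : ∀ i, Pn (J i) = P U * P V ^ (n - 1) := fun i => by
    rw [Measure.pi_pi, Finset.prod_eq_mul_prod_sdiff_singleton_of_mem (Finset.mem_univ i)]
    · simp only [if_true]
      congr 1
      rw [Finset.prod_congr rfl (g := fun _ => P V), Finset.prod_const]
      · congr 1
        rw [Finset.card_sdiff_of_subset (by simp)]
        simp
      · intro k hk
        rw [if_neg (by simpa using hk)]
  have hJd : Pairwise (Function.onFun Disjoint J) := fun i k hik => by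
    refine Set.disjoint_left.2 fun ω h1 h2 => ?_
    have h1 := h1 i (mem_univ _)
    have h2 := h2 i (mem_univ _)
    simp only [if_true, if_neg hik] at h1 h2
    exact hUV _ h1 h2
  have hsub : ⋃ i, J i ⊆ {ω | scaledMax n (fun i => ζ (ω i)) ∈ G} := by
    refine iUnion_subset fun i ω hω => ?_
    have hω : ∀ k ∈ univ, ω k ∈ if k = i then U else V := hω
    have hi : (n : ℝ≥0)⁻¹ • ζ (ω i) ∈ A := by
      have : ω i ∈ U := by simpa only [if_true] using hω i (mem_univ _)
      exact this
    have hk : ∀ k, k ≠ i → dist ((n : ℝ≥0)⁻¹ • ζ (ω k)) 0 ≤ e := fun k hki => by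
      have : ω k ∈ V := by simpa only [if_neg hki] using hω k (mem_univ _)
      exact this
    refine hAG _ hi _ (dist_le_of_le_max he (fun t => ?_) fun t => ?_)
    · exact (scaledMax_apply_le_iff hn (fun i => ζ (ω i)) t _).1 le_rfl i
    · have h := (scaledMax_apply_le_iff hn (fun i => ζ (ω i)) t
        (max (((n : ℝ≥0)⁻¹ • ζ (ω i)) t) e.toNNReal)).2 fun k => by
          by_cases hki : k = i
          · exact hki ▸ le_max_left _ _
          · refine le_max_of_le_right ?_
            rw [← NNReal.coe_le_coe, Real.coe_toNNReal _ he]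
            exact (apply_le_dist_zero _ t).trans (hk k hki)
      have h' : (scaledMax n (fun i => ζ (ω i)) t : ℝ) ≤
        (max (((n : ℝ≥0)⁻¹ • ζ (ω i)) t) e.toNNReal : ℝ≥0) := h
      rwa [NNReal.coe_max, Real.coe_toNNReal _ he] at h'
  have hV' : Pn.real {ω | dist (scaledMax n fun i => ζ (ω i)) 0 ≤ e} = P.real V ^ n := by
    have : {ω : Fin n → Ω | dist (scaledMax n fun i => ζ (ω i)) 0 ≤ e} = univ.pi fun _ => V := by
      ext ω
      rw [mem_ofPred_eq, dist_scaledMax_zero_le_iff hn _ he, Set.mem_pi]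
      exact ⟨fun h i _ => h i, fun h i => h i (mem_univ i)⟩
    rw [this, measureReal_def, Measure.pi_pi]
    simp [measureReal_def]
  calc n * P.real U * Pn.real {ω | dist (scaledMax n fun i => ζ (ω i)) 0 ≤ e}
      ≤ n * P.real U * P.real V ^ (n - 1) := by
        rw [hV']
        refine mul_le_mul_of_nonneg_left ?_ (by positivity)
        exact pow_le_pow_of_le_one measureReal_nonneg measureReal_le_one (Nat.sub_le _ _)
    _ = Pn.real (⋃ i, J i) := by
        rw [measureReal_def (μ := Pn), measure_iUnion hJd hJm, tsum_fintype]
        simp only [hJP, Finset.sum_const, Finset.card_univ, Fintype.card_fin, nsmul_eq_mul]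
        simp [measureReal_def, mul_assoc]
    _ ≤ _ := measureReal_mono hsub

/-- The union bound for the tail of the maximum of `n` independent copies. -/
lemma real_lt_dist_scaledMax_le (hζ : Measurable ζ) {n : ℕ} (hn : 0 < n) {e : ℝ} (he : 0 ≤ e) :
    (Measure.pi fun _ : Fin n => P).real {ω | e < dist (scaledMax n fun i => ζ (ω i)) 0} ≤
      n * P.real {ω | n * e < dist (ζ ω) 0} := by
  have hn' : (0 : ℝ) < n := by exact_mod_cast hn
  have hset : {ω : Fin n → Ω | e < dist (scaledMax n fun i => ζ (ω i)) 0} =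
      ⋃ i, Function.eval i ⁻¹' {ω | n * e < dist (ζ ω) 0} := by
    ext ω
    simp only [mem_ofPred_eq, mem_iUnion, mem_preimage, Function.eval]
    rw [← not_le, dist_scaledMax_zero_le_iff hn _ he]
    push Not
    refine exists_congr fun i => ?_
    rw [dist_smul_zero, NNReal.coe_inv, NNReal.coe_natCast, lt_inv_mul_iff₀ hn']
  rw [hset]
  refine (measureReal_iUnion_fintype_le _).trans ?_
  have hmeas : MeasurableSet {ω | n * e < dist (ζ ω) 0} := hζ (measurableSet_lt_dist_zero _)
  have : ∀ i : Fin n, (Measure.pi fun _ : Fin n => P).real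
      (Function.eval i ⁻¹' {ω | n * e < dist (ζ ω) 0}) = P.real {ω | n * e < dist (ζ ω) 0} :=
    fun i => by
      rw [measureReal_def, (measurePreserving_eval (fun _ : Fin n => P) i).measure_preimage
        hmeas.nullMeasurableSet, measureReal_def]
  rw [Finset.sum_congr rfl fun i _ => this i]
  simp

end ProductSpace

end M3

namespace M3

/-! ### Portmanteau bounds with an additive error. -/

section Portmanteau

variable {ι E Ω' : Type*} {Ω : ι → Type*} {m : ∀ i, MeasurableSpace (Ω i)}
  {Pn : (i : ι) → Measure (Ω i)} [∀ i, IsProbabilityMeasure (Pn i)]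
  {m' : MeasurableSpace Ω'} {P' : Measure Ω'} [IsProbabilityMeasure P']
  [TopologicalSpace E] [TopologicalSpace.PseudoMetrizableSpace E] [MeasurableSpace E]
  [BorelSpace E] {X : (i : ι) → Ω i → E} {Z : Ω' → E} {l : Filter ι}

lemma eventually_real_closed_le (h : TendstoInDistribution X l Z Pn P') {G : Set E}
    (hG : IsClosed G) {δ : ℝ} (hδ : 0 < δ) :
    ∀ᶠ i in l, (Pn i).real {ω | X i ω ∈ G} ≤ P'.real {ω | Z ω ∈ G} + δ := by
  let _ := TopologicalSpace.pseudoMetrizableSpacePseudoMetric E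
  have h1 := ProbabilityMeasure.limsup_measure_closed_le_of_tendsto h.tendsto hG
  have h2 : (P'.map Z) G < P'.map Z G + ENNReal.ofReal δ := by
    refine ENNReal.lt_add_right ?_ (by simpa using hδ)
    rw [Measure.map_apply_of_aemeasurable h.aemeasurable_limit hG.measurableSet]
    exact measure_ne_top _ _
  filter_upwards [eventually_lt_of_limsup_lt (h1.trans_lt h2)] with i hi
  have hi : ((Pn i).map (X i)) G < P'.map Z G + ENNReal.ofReal δ := hi
  rw [Measure.map_apply_of_aemeasurable h.aemeasurable_limit hG.measurableSet,
    Measure.map_apply_of_aemeasurable (h.forall_aemeasurable i) hG.measurableSet] at hi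
  have := ENNReal.toReal_mono (by finiteness) hi.le
  rwa [ENNReal.toReal_add (by finiteness) (by finiteness), ENNReal.toReal_ofReal hδ.le] at this

lemma eventually_le_real_open (h : TendstoInDistribution X l Z Pn P') {G : Set E}
    (hG : IsOpen G) {δ : ℝ} (hδ : 0 < δ) :
    ∀ᶠ i in l, P'.real {ω | Z ω ∈ G} - δ ≤ (Pn i).real {ω | X i ω ∈ G} := by
  filter_upwards [eventually_real_closed_le h hG.isClosed_compl hδ] with i hi
  have h1 : (Pn i).real {ω | X i ω ∈ Gᶜ} = 1 - (Pn i).real {ω | X i ω ∈ G} :=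
    probReal_compl_eq_one_sub₀ ((h.forall_aemeasurable i).nullMeasurable hG.measurableSet)
  have h2 : P'.real {ω | Z ω ∈ Gᶜ} = 1 - P'.real {ω | Z ω ∈ G} :=
    probReal_compl_eq_one_sub₀ (h.aemeasurable_limit.nullMeasurable hG.measurableSet)
  linarith

end Portmanteau

/-! ### Tail asymptotics in the max-domain of attraction. -/

variable {T : Type*} [TopologicalSpace T] [CompactSpace T]
  {Ω : Type*} [MeasurableSpace Ω] {P : Measure Ω} [IsProbabilityMeasure P]
  {Ω' : Type*} [MeasurableSpace Ω'] {P' : Measure Ω'} [IsProbabilityMeasure P']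
  {ζ : Ω → C(T, ℝ≥0)} {Z : Ω' → C(T, ℝ≥0)} {Y : ℕ → Ω' → C(T, ℝ≥0)} {μ : Measure C(T, ℝ≥0)}
  {c : ℝ}

lemma lt_dist_zero_of_mem_cthickening {D : Set C(T, ℝ≥0)} (hD1 : ∀ g ∈ D, 1 ≤ dist g 0)
    {ε δ : ℝ} (hε : 0 ≤ ε) (hδ : ε < δ) {g : C(T, ℝ≥0)} (hg : g ∈ Metric.cthickening ε D) :
    1 - δ < dist g 0 := by
  rw [Metric.cthickening_eq_iInter_thickening hε] at hg
  obtain ⟨f, hf, hgf⟩ := Metric.mem_thickening_iff.1 (mem_iInter₂.1 hg δ hδ)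
  have := dist_triangle_left f 0 g
  linarith [hD1 f hf]

/-- A small thickening of `D` stays away from 0, hence has finite mass, and continuity from above
applies. The radius is doubled because the approximation is made twice: once for the copies, once
for the Poisson points. -/
lemma exists_thickening_real_lt (hμ : IsHomogeneousMeasure μ c) {D : Set C(T, ℝ≥0)}
    (hD : IsClosed D) (hD1 : ∀ g ∈ D, 1 ≤ dist g 0) {r : ℝ} (hr : μ.real D < r) :
    ∃ ε : ℝ, 0 < ε ∧ ε ≤ 1 / 4 ∧ μ.real (Metric.cthickening (2 * ε) D) < r := by
  have hsub : ∀ ε : ℝ, 0 ≤ ε → ε ≤ 1 / 2 → ∀ g ∈ Metric.cthickening ε D, 1 / 4 ≤ dist g 0 := by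
    intro ε hε hε2 g hg
    have := lt_dist_zero_of_mem_cthickening hD1 hε (hε2.trans_lt (show 1 / 2 < 3 / 4 by norm_num)) hg
    linarith
  have h1 : Tendsto (fun ε => μ (Metric.cthickening ε D)) (𝓝 0) (𝓝 (μ D)) :=
    tendsto_measure_cthickening_of_isClosed ⟨1 / 2, by norm_num, hμ.measure_ne_top (by norm_num)
      (hsub (1 / 2) (by norm_num) le_rfl)⟩ hD
  have hfin : μ D ≠ ∞ := hμ.measure_ne_top one_pos hD1
  have h2 : Tendsto (fun ε => μ.real (Metric.cthickening (2 * ε) D)) (𝓝[>] 0) (𝓝 (μ.real D)) := by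
    refine (ENNReal.tendsto_toReal hfin).comp (h1.comp ?_)
    have : Tendsto (fun ε : ℝ => 2 * ε) (𝓝 0) (𝓝 (2 * 0)) := tendsto_id.const_mul 2
    rw [mul_zero] at this
    exact this.mono_left nhdsWithin_le_nhds
  have h3 : ∀ᶠ ε : ℝ in 𝓝[>] 0, ε ≤ 1 / 4 :=
    nhdsWithin_le_nhds (eventually_le_nhds (by norm_num))
  obtain ⟨ε, ⟨h4, h5⟩, h6⟩ := ((h3.and (h2.eventually_lt_const hr)).and
    self_mem_nhdsWithin).exists
  exact ⟨ε, h6, h4, h5⟩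

/-- At a fixed high level, the expected number of exceedances along integers is bounded by the
exponent measure. -/
lemma exists_level_eventually_le (hζ : Measurable ζ) (hμ : IsHomogeneousMeasure μ c)
    (hY : IsPoissonSup Z Y μ P')
    (hconv : TendstoInDistribution (fun (n : ℕ) (ω : Fin n → Ω) => scaledMax n fun i => ζ (ω i))
      atTop Z (fun n => Measure.pi fun _ : Fin n => P) P')
    {D : Set C(T, ℝ≥0)} (hD : IsClosed D) (hD1 : ∀ g ∈ D, 1 ≤ dist g 0) {r : ℝ}
    (hr : μ.real D < r) :
    ∃ x : ℝ≥0, 0 < x ∧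
      ∀ᶠ n : ℕ in atTop, n * x * P.real {ω | (n * x : ℝ≥0)⁻¹ • ζ ω ∈ D} ≤ r := by
  obtain ⟨ε, hε, hε4, hεr⟩ := exists_thickening_real_lt hμ hD hD1 hr
  set m := μ.real (Metric.cthickening (2 * ε) D) with hm
  -- `hden` concerns the lower bound for the chance that all copies stay below `ε x`, and `hnum`
  -- concerns `x` times the upper bound `m/x + (c/(εx))^2 + 1/x^2` for the chance that the maximum
  -- lies in `G`. The term `1/x^2` is the portmanteau error `δ`, chosen to be negligible against
  -- `1/x`. Thus `x` can be fixed before `n` grows.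
  have hden : Tendsto (fun x : ℝ => 1 - 2 * c / (ε * x) - 1 / x ^ 2) atTop (𝓝 1) := by
    have h1 : Tendsto (fun x : ℝ => 2 * c / (ε * x)) atTop (𝓝 0) :=
      (tendsto_id.const_mul_atTop hε).const_div_atTop _
    have h2 : Tendsto (fun x : ℝ => 1 / x ^ 2) atTop (𝓝 0) :=
      (tendsto_pow_atTop two_ne_zero).const_div_atTop _
    simpa using (h1.const_sub 1).sub h2
  have hnum : Tendsto (fun x : ℝ => m + ((c / ε) ^ 2 + 1) / x) atTop (𝓝 m) := by
    simpa using (tendsto_id.const_div_atTop ((c / ε) ^ 2 + 1)).const_add m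
  have hquot := hnum.div hden one_ne_zero
  rw [div_one] at hquot
  obtain ⟨x, ⟨hx1, hx2⟩, hx0⟩ := (((hquot.eventually_lt_const hεr).and
    (hden.eventually_const_lt zero_lt_one)).and (eventually_gt_atTop 0)).exists
  simp only [Pi.div_apply] at hx1
  lift x to ℝ≥0 using hx0.le
  have hx : 0 < x := hx0
  have hscale : ∀ s : Set C(T, ℝ≥0), IsClosed s → IsClosed {g | x⁻¹ • g ∈ s} := fun s hs =>
    hs.preimage (continuous_const_smul _)
  set G : Set C(T, ℝ≥0) := {g | x⁻¹ • g ∈ Metric.cthickening ε D} with hG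
  set G' : Set C(T, ℝ≥0) := {g | x⁻¹ • g ∈ Metric.cthickening (2 * ε) D} with hG'
  have hεx : 0 < ε * x := by positivity
  have hdist : ∀ f g : C(T, ℝ≥0), dist f g ≤ ε * x → dist (x⁻¹ • f) (x⁻¹ • g) ≤ ε := by
    intro f g h
    refine (dist_smul_smul_le _ _ _).trans ?_
    rw [NNReal.coe_inv, inv_mul_le_iff₀ hx0]
    linarith
  have hGcl : IsClosed G := hscale _ Metric.isClosed_cthickening
  have hG'cl : IsClosed G' := hscale _ Metric.isClosed_cthickening
  have hGbig : ∀ g ∈ G, ε * x < dist g 0 := by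
    intro g hg
    have hg : x⁻¹ • g ∈ Metric.cthickening ε D := hg
    have h1 := lt_dist_zero_of_mem_cthickening hD1 hε.le
      (hε4.trans_lt (show 1 / 4 < 1 / 2 by norm_num)) hg
    rw [dist_smul_zero, NNReal.coe_inv, inv_mul_eq_div, lt_div_iff₀ hx0] at h1
    nlinarith
  have hGG' : ∀ g ∈ G, ∀ f, dist g f ≤ ε * x → f ∈ G' := by
    intro g hg f hgf
    have h1 : x⁻¹ • f ∈ Metric.cthickening ε (Metric.cthickening ε D) :=
      Metric.mem_cthickening_of_dist_le _ _ _ _ hg (by rw [dist_comm]; exact hdist _ _ hgf)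
    have h2 := Metric.cthickening_cthickening_subset hε.le hε.le D h1
    rwa [← two_mul] at h2
  have hμG' : μ G' = (x⁻¹ : ℝ≥0) * μ (Metric.cthickening (2 * ε) D) :=
    hμ.scaling x _ hx Metric.isClosed_cthickening.measurableSet
  have hcfin : μ (Metric.cthickening (2 * ε) D) ≠ ∞ := by
    refine hμ.measure_ne_top (y := 1 / 4) (by norm_num) fun g hg => ?_
    have := lt_dist_zero_of_mem_cthickening hD1 (by positivity)
      (show 2 * ε < 3 / 4 by linarith) hg
    linarith
  have hG'fin : μ G' ≠ ∞ := by
    rw [hμG']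
    exact ENNReal.mul_ne_top ENNReal.coe_ne_top hcfin
  have hG'real : μ.real G' = m / x := by
    rw [measureReal_def, hμG', ENNReal.toReal_mul, hm, measureReal_def]
    simp [inv_mul_eq_div]
  have hD'm : MeasurableSet {g : C(T, ℝ≥0) | x⁻¹ • g ∈ D} := (hscale D hD).measurableSet
  have hD'G : ∀ g ∈ {g : C(T, ℝ≥0) | x⁻¹ • g ∈ D}, ∀ f, dist f g ≤ ε * x → f ∈ G := by
    intro g hg f hfg
    have hg : x⁻¹ • g ∈ D := hg
    exact Metric.mem_cthickening_of_dist_le (x⁻¹ • f) (x⁻¹ • g) ε D hg (hdist f g hfg)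
  have hD'big : ∀ g ∈ {g : C(T, ℝ≥0) | x⁻¹ • g ∈ D}, ε * x < dist g 0 := fun g hg =>
    hGbig g (hD'G g hg g (by rw [dist_self]; exact hεx.le))
  have hδ : (0 : ℝ) < 1 / x ^ 2 := by positivity
  have hub := hY.real_mem_le hμ hεx hGbig hGG' hG'cl.measurableSet hG'fin
  have hsmall : 1 - 2 * c / (ε * x) ≤ P'.real {ω | dist (Z ω) 0 < ε * x} := by
    have h1 := hY.real_le_dist_le hμ hεx
    have h2 : P'.real {ω | ε * x ≤ dist (Z ω) 0} = 1 - P'.real {ω | dist (Z ω) 0 < ε * x} := by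
      rw [← probReal_compl_eq_one_sub₀]
      · congr 1
        ext ω
        simp
      · exact hconv.aemeasurable_limit.nullMeasurable
          (isOpen_lt continuous_dist_zero continuous_const).measurableSet
    linarith
  refine ⟨x, hx, ?_⟩
  filter_upwards [eventually_real_closed_le hconv hGcl hδ, eventually_le_real_open hconv
    (isOpen_lt continuous_dist_zero continuous_const : IsOpen {g : C(T, ℝ≥0) | dist g 0 < ε * x}) hδ,
    eventually_gt_atTop 0] with n h1 h2 hn
  set p := P.real {ω | (n * x : ℝ≥0)⁻¹ • ζ ω ∈ D} with hp
  have hp' : P.real {ω | (n : ℝ≥0)⁻¹ • ζ ω ∈ {g | x⁻¹ • g ∈ D}} = p := by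
    rw [hp]
    congr 1
    ext ω
    simp only [mem_ofPred_eq, smul_smul, mul_inv, mul_comm]
  have hbox := mul_real_mem_le (P := P) hζ hn hεx.le hD'm hD'big hD'G
  rw [hp'] at hbox
  have hq : 1 - 2 * c / (ε * x) - 1 / (x : ℝ) ^ 2 ≤
      (Measure.pi fun _ : Fin n => P).real
        {ω | dist (scaledMax n fun i => ζ (ω i)) 0 ≤ ε * x} := by
    refine (sub_le_sub_right hsmall _).trans (h2.trans (measureReal_mono fun ω hω => ?_))
    have hω : dist (scaledMax n fun i => ζ (ω i)) 0 < ε * x := hω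
    exact hω.le
  have hp0 : 0 ≤ p := measureReal_nonneg
  have h3 : n * p * (1 - 2 * c / (ε * x) - 1 / (x : ℝ) ^ 2) ≤
      m / x + (c / (ε * x)) ^ 2 + 1 / x ^ 2 := by
    rw [hG'real] at hub
    exact (mul_le_mul_of_nonneg_left hq (by positivity)).trans (by linarith)
  have h4 : n * x * p * (1 - 2 * c / (ε * x) - 1 / (x : ℝ) ^ 2) ≤
      m + ((c / ε) ^ 2 + 1) / x := by
    have := mul_le_mul_of_nonneg_left h3 hx0.le
    calc n * x * p * (1 - 2 * c / (ε * x) - 1 / (x : ℝ) ^ 2)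
        = x * (n * p * (1 - 2 * c / (ε * x) - 1 / (x : ℝ) ^ 2)) := by ring
      _ ≤ _ := this
      _ = _ := by field_simp; ring
  exact ((le_div_iff₀ hx2).2 h4).trans hx1.le

/-- The exponent measure of a closed set bounds the tail asymptotics of the events whose
rescalings lie in that set. -/
theorem eventually_mul_real_le (hζ : Measurable ζ) (hμ : IsHomogeneousMeasure μ c)
    (hY : IsPoissonSup Z Y μ P')
    (hconv : TendstoInDistribution (fun (n : ℕ) (ω : Fin n → Ω) => scaledMax n fun i => ζ (ω i))
      atTop Z (fun n => Measure.pi fun _ : Fin n => P) P')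
    {D : Set C(T, ℝ≥0)} (hD : IsClosed D) (hD1 : ∀ g ∈ D, 1 ≤ dist g 0) {r : ℝ}
    (hr : μ.real D < r) {S : ℝ → Set Ω}
    (hS : ∀ (a : ℝ) (b : ℝ≥0), 0 < b → b ≤ a → ∀ ω ∈ S a, b⁻¹ • ζ ω ∈ D) :
    ∀ᶠ a : ℝ in atTop, a * P.real (S a) ≤ r := by
  obtain ⟨s, hs1, hs2⟩ := exists_between hr
  obtain ⟨x, hx, hev⟩ := exists_level_eventually_le hζ hμ hY hconv hD hD1 hs1
  have hx' : (0 : ℝ) < x := hx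
  -- Rounding down gives `n x ≤ a`, so `hS` applies with `b = n x`. The resulting factor `(n + 1)/n`
  -- is absorbed by the gap between `s` and `r`.
  have hfloor : Tendsto (fun a : ℝ => ⌊a / x⌋₊) atTop atTop :=
    tendsto_nat_floor_atTop.comp (tendsto_id.atTop_div_const hx')
  have hlim : Tendsto (fun n : ℕ => s + s * (1 / (n : ℝ))) atTop (𝓝 s) := by
    simpa using (tendsto_one_div_atTop_nhds_zero_nat.const_mul s).const_add s
  filter_upwards [hfloor.eventually hev, hfloor.eventually (eventually_gt_atTop 0),
    hfloor.eventually (hlim.eventually_lt_const hs2), eventually_gt_atTop 0] with a h1 h2 h3 ha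
  set n := ⌊a / x⌋₊
  have hn : (0 : ℝ) < n := by exact_mod_cast h2
  have hna : (n : ℝ) * x ≤ a := by
    rw [← le_div_iff₀ hx']
    exact Nat.floor_le (by positivity)
  have han : a ≤ (n + 1) * x := by
    rw [← div_le_iff₀ hx']
    exact (Nat.lt_floor_add_one _).le
  have hsub : S a ⊆ {ω | (n * x : ℝ≥0)⁻¹ • ζ ω ∈ D} := fun ω hω =>
    hS a (n * x) (mul_pos (by exact_mod_cast h2) hx) (by push_cast; exact hna) ω hω
  set p := P.real {ω | (n * x : ℝ≥0)⁻¹ • ζ ω ∈ D}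
  have hp0 : 0 ≤ p := measureReal_nonneg
  calc a * P.real (S a) ≤ (n + 1) * x * p :=
        mul_le_mul han (measureReal_mono hsub) measureReal_nonneg (by positivity)
    _ = n * x * p + n * x * p * (1 / n) := by field_simp
    _ ≤ s + s * (1 / n) := by gcongr
    _ ≤ r := h3.le

/-- The tail of the supremum is at least the one given by the exponent measure. -/
theorem eventually_le_mul_real (hζ : Measurable ζ) (hμ : IsHomogeneousMeasure μ c)
    (hY : IsPoissonSup Z Y μ P')
    (hconv : TendstoInDistribution (fun (n : ℕ) (ω : Fin n → Ω) => scaledMax n fun i => ζ (ω i))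
      atTop Z (fun n => Measure.pi fun _ : Fin n => P) P') {r : ℝ} (hr : r < c) :
    ∀ᶠ a : ℝ in atTop, r ≤ a * P.real {ω | a ≤ dist (ζ ω) 0} := by
  rcases lt_or_ge r 0 with hr0 | hr0
  · filter_upwards [eventually_ge_atTop 0] with a ha
    exact hr0.le.trans (by positivity)
  obtain ⟨s, hs1, hs2⟩ := exists_between hr
  have hs0 : 0 < s := hr0.trans_lt hs1
  have hc := hμ.const_nonneg
  -- The Poisson probability `1 - exp(-c/x)` is linear in `c/x` only to first order, so the level
  -- must be high; `1/x^2` again leaves room for the portmanteau error.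
  have hlevel : Tendsto (fun x : ℝ => x * (1 - Real.exp (-(c / x)) - 1 / x ^ 2)) atTop (𝓝 c) := by
    have h1 : Tendsto (fun x : ℝ => c - (c ^ 2 + 1) / x) atTop (𝓝 c) := by
      simpa using (tendsto_id.const_div_atTop (c ^ 2 + 1)).const_sub c
    have h2 : Tendsto (fun x : ℝ => c - 1 / x) atTop (𝓝 c) := by
      simpa using (tendsto_id.const_div_atTop (1 : ℝ)).const_sub c
    refine tendsto_of_tendsto_of_tendsto_of_le_of_le' h1 h2 ?_ ?_
    · filter_upwards [eventually_gt_atTop 0, eventually_ge_atTop c] with x hx hxc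
      have h4 : |Real.exp (-(c / x)) - 1 - -(c / x)| ≤ (-(c / x)) ^ 2 :=
        Real.abs_exp_sub_one_sub_id_le (by
          rw [abs_neg, abs_of_nonneg (by positivity), div_le_one hx]; exact hxc)
      have h5 := (abs_le.1 h4).2
      have h6 : c / x - (c / x) ^ 2 ≤ 1 - Real.exp (-(c / x)) := by
        rw [neg_sq] at h5; linarith
      calc c - (c ^ 2 + 1) / x = x * (c / x - (c / x) ^ 2 - 1 / x ^ 2) := by
            field_simp; ring
        _ ≤ _ := by gcongr
    · filter_upwards [eventually_gt_atTop 0] with x hx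
      have h3 := Real.add_one_le_exp (-(c / x))
      calc x * (1 - Real.exp (-(c / x)) - 1 / x ^ 2) ≤ x * (c / x - 1 / x ^ 2) := by
            gcongr; linarith
        _ = c - 1 / x := by field_simp
  obtain ⟨x, hxs, hx⟩ := ((hlevel.eventually_const_lt hs2).and (eventually_gt_atTop 0)).exists
  have hδ : (0 : ℝ) < 1 / x ^ 2 := by positivity
  -- For a lower bound the rounding goes up: exceeding `n x ≥ a` implies exceeding `a`.
  have hceil : Tendsto (fun a : ℝ => ⌈a / x⌉₊) atTop atTop :=
    tendsto_nat_ceil_atTop.comp (tendsto_id.atTop_div_const hx)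
  have hlim : Tendsto (fun n : ℕ => s - s * (1 / (n : ℝ))) atTop (𝓝 s) := by
    simpa using (tendsto_one_div_atTop_nhds_zero_nat.const_mul s).const_sub s
  filter_upwards [hceil.eventually (eventually_le_real_open hconv
      (isOpen_lt continuous_const continuous_dist_zero : IsOpen {g : C(T, ℝ≥0) | x < dist g 0}) hδ),
    hceil.eventually (eventually_gt_atTop 0), hceil.eventually (hlim.eventually_const_lt hs1),
    eventually_gt_atTop 0] with a h1 h2 h3 ha
  set n := ⌈a / x⌉₊
  have hn : (0 : ℝ) < n := by exact_mod_cast h2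
  have hna : a ≤ n * x := by
    rw [← div_le_iff₀ hx]
    exact Nat.le_ceil _
  have han : (n - 1) * x ≤ a := by
    rw [← le_div_iff₀ hx]
    linarith [Nat.ceil_lt_add_one (show 0 ≤ a / x by positivity)]
  set p := P.real {ω | n * x < dist (ζ ω) 0}
  have hp : p ≤ P.real {ω | a ≤ dist (ζ ω) 0} :=
    measureReal_mono fun ω hω => hna.trans (le_of_lt hω)
  have hn1 : (1 : ℝ) ≤ n := by exact_mod_cast h2
  have hsp : s ≤ n * x * p := by
    have h4 := hY.le_real_lt_dist hμ hx
    have h5 := real_lt_dist_scaledMax_le (P := P) hζ h2 hx.le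
    have h6 : 1 - Real.exp (-(c / x)) - 1 / x ^ 2 ≤ n * p :=
      (sub_le_sub_right h4 _).trans (h1.trans h5)
    calc s ≤ x * (1 - Real.exp (-(c / x)) - 1 / x ^ 2) := hxs.le
      _ ≤ x * (n * p) := by gcongr
      _ = n * x * p := by ring
  have hp0 : 0 ≤ p := measureReal_nonneg
  calc r ≤ s - s * (1 / n) := h3.le
    _ = s * (1 - 1 / n) := by ring
    _ ≤ n * x * p * (1 - 1 / n) := by
        refine mul_le_mul_of_nonneg_right hsp ?_
        rw [sub_nonneg, div_le_one hn]
        exact hn1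
    _ = (n - 1) * x * p := by field_simp
    _ ≤ a * P.real {ω | a ≤ dist (ζ ω) 0} := mul_le_mul han hp hp0 ha.le

end M3

namespace M3

/-! ### Void and multiple-point probabilities of a Poisson process. -/

section Poisson

variable {Ω S : Type*} [MeasurableSpace S]

lemma pointMeasure_apply (X : ℕ → Ω → S) (ω : Ω) {A : Set S} (hA : MeasurableSet A) :
    pointMeasure X ω A = ∑' i, A.indicator 1 (X i ω) := by
  rw [pointMeasure, Measure.sum_apply _ hA]
  simp [Measure.dirac_apply' _ hA]

lemma pointMeasure_eq_zero_iff (X : ℕ → Ω → S) (ω : Ω) {A : Set S} (hA : MeasurableSet A) :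
    pointMeasure X ω A = 0 ↔ ∀ i, X i ω ∉ A := by
  rw [pointMeasure_apply X ω hA, ENNReal.tsum_eq_zero]
  simp

lemma two_le_pointMeasure (X : ℕ → Ω → S) {ω : Ω} {A : Set S} (hA : MeasurableSet A) {i k : ℕ}
    (hik : i ≠ k) (hi : X i ω ∈ A) (hk : X k ω ∈ A) : 2 ≤ pointMeasure X ω A := by
  rw [pointMeasure_apply X ω hA]
  refine le_trans ?_ (ENNReal.sum_le_tsum {i, k})
  rw [Finset.sum_pair hik]
  simp [hi, hk, one_add_one_eq_two]

variable [MeasurableSpace Ω] {X : ℕ → Ω → S} {ν : Measure S} {P : Measure Ω}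

lemma IsPoissonPointProcess.measurable_count (h : IsPoissonPointProcess X ν P) {A : Set S}
    (hA : MeasurableSet A) : Measurable fun ω => pointMeasure X ω A := by
  simp_rw [pointMeasure_apply X _ hA]
  exact Measurable.tsum fun i => (measurable_one.indicator hA).comp (h.measurable i)

lemma IsPoissonPointProcess.measure_count (h : IsPoissonPointProcess X ν P) {A : Set S}
    (hA : MeasurableSet A) (hν : ν A ≠ ∞) {s : Set ℝ≥0∞} (hs : MeasurableSet s) :
    P.real {ω | pointMeasure X ω A ∈ s} =
      (poissonMeasure (ν A).toNNReal).real {k : ℕ | (k : ℝ≥0∞) ∈ s} := by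
  have h1 := congrArg (fun m => m s) (h.map_count A hA hν)
  rw [Measure.map_apply (h.measurable_count hA) hs,
    Measure.map_apply (measurable_of_countable _) hs] at h1
  exact congrArg ENNReal.toReal h1

variable [IsProbabilityMeasure P]

lemma IsPoissonPointProcess.real_exists_mem (h : IsPoissonPointProcess X ν P) {A : Set S}
    (hA : MeasurableSet A) (hν : ν A ≠ ∞) :
    P.real {ω | ∃ i, X i ω ∈ A} = 1 - Real.exp (-ν.real A) := by
  have h1 := h.measure_count hA hν (measurableSet_singleton (0 : ℝ≥0∞))
  have h2 : {k : ℕ | (k : ℝ≥0∞) ∈ ({0} : Set ℝ≥0∞)} = {0} := by ext k; simp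
  rw [h2, poissonMeasure_real_singleton] at h1
  have h3 : {ω | ∃ i, X i ω ∈ A} = {ω | pointMeasure X ω A ∈ ({0} : Set ℝ≥0∞)}ᶜ := by
    ext ω
    simp [pointMeasure_eq_zero_iff X ω hA]
  have h4 : MeasurableSet {ω | pointMeasure X ω A ∈ ({0} : Set ℝ≥0∞)} :=
    h.measurable_count hA (measurableSet_singleton _)
  rw [h3, probReal_compl_eq_one_sub h4, h1, ENNReal.coe_toNNReal_eq_toReal]
  simp [measureReal_def]

lemma IsPoissonPointProcess.real_two_mem_le (h : IsPoissonPointProcess X ν P) {A : Set S}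
    (hA : MeasurableSet A) (hν : ν A ≠ ∞) :
    P.real {ω | ∃ i k, i ≠ k ∧ X i ω ∈ A ∧ X k ω ∈ A} ≤ ν.real A ^ 2 := by
  have h1 := h.measure_count hA hν (measurableSet_Ici (a := (2 : ℝ≥0∞)))
  have h2 : {k : ℕ | (k : ℝ≥0∞) ∈ Ici (2 : ℝ≥0∞)} = ((({0, 1} : Finset ℕ) : Set ℕ))ᶜ := by
    ext k
    have : (2 : ℝ≥0∞) ≤ k ↔ 2 ≤ k := by exact_mod_cast Nat.cast_le (α := ℝ≥0∞) (m := 2) (n := k)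
    simp only [mem_ofPred_eq, mem_Ici, this, mem_compl_iff, Finset.mem_coe, Finset.mem_insert,
      Finset.mem_singleton]
    omega
  have h3 : (poissonMeasure (ν A).toNNReal).real (({0, 1} : Finset ℕ) : Set ℕ) =
      Real.exp (-ν.real A) + Real.exp (-ν.real A) * ν.real A := by
    rw [← sum_measureReal_singleton, Finset.sum_pair zero_ne_one]
    simp only [poissonMeasure_real_singleton, ENNReal.coe_toNNReal_eq_toReal]
    simp [measureReal_def]
  rw [h2, probReal_compl_eq_one_sub (by measurability), h3] at h1
  refine (measureReal_mono (s₂ := {ω | pointMeasure X ω A ∈ Ici 2}) ?_).trans ?_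
  · rintro ω ⟨i, k, hik, hi, hk⟩
    exact two_le_pointMeasure X hA hik hi hk
  · rw [h1]
    have h4 : 0 ≤ ν.real A := measureReal_nonneg
    -- With `m = ν A`, the bound `exp(-m) ≥ 1 - m` gives `1 - exp(-m)(1 + m) ≤ 1 - (1 - m)(1 + m) =
    -- m^2`.
    nlinarith [Real.add_one_le_exp (-ν.real A)]

end Poisson

/-! ### The measure `u⁻² du`: tails and homogeneity. -/

section Frechet

instance : SFinite frechetIntensity := by
  unfold frechetIntensity
  infer_instance

lemma frechetIntensity_apply {A : Set ℝ} (hA : MeasurableSet A) :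
    frechetIntensity A = ∫⁻ u, (Ioi 0 ∩ A).indicator (fun u => ENNReal.ofReal (u ^ 2)⁻¹) u := by
  rw [frechetIntensity, withDensity_apply _ hA, lintegral_indicator (measurableSet_Ioi.inter hA),
    Measure.restrict_restrict hA, inter_comm]

lemma frechetIntensity_Ioi {y : ℝ} (hy : 0 < y) :
    frechetIntensity (Ioi y) = ENNReal.ofReal (1 / y) := by
  rw [frechetIntensity_apply measurableSet_Ioi, Ioi_inter_Ioi, sup_eq_right.2 hy.le,
    lintegral_indicator measurableSet_Ioi]
  have h1 : ∀ u ∈ Ioi y, (u ^ 2)⁻¹ = u ^ (-2 : ℝ) := fun u hu => by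
    rw [Real.rpow_neg (hy.trans hu).le]
    norm_cast
  have h2 : IntegrableOn (fun u : ℝ => (u ^ 2)⁻¹) (Ioi y) :=
    (integrableOn_Ioi_rpow_of_lt (by norm_num : (-2 : ℝ) < -1) hy).congr_fun
      (fun u hu => (h1 u hu).symm) measurableSet_Ioi
  rw [← ofReal_integral_eq_lintegral_ofReal h2 (ae_of_all _ fun u => by positivity),
    setIntegral_congr_fun measurableSet_Ioi h1, integral_Ioi_rpow_of_lt (by norm_num) hy]
  congr 1
  norm_num
  rw [Real.rpow_neg_one]

lemma frechetIntensity_Ici {y : ℝ} (hy : 0 < y) :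
    frechetIntensity (Ici y) = ENNReal.ofReal (1 / y) := by
  rw [← frechetIntensity_Ioi hy]
  have : frechetIntensity ≪ volume :=
    (withDensity_absolutelyContinuous _ _).trans Measure.restrict_le_self.absolutelyContinuous
  exact measure_congr (this.ae_eq Ioi_ae_eq_Ici.symm)

lemma frechetIntensity_preimage_mul {x : ℝ} (hx : 0 < x) {A : Set ℝ} (hA : MeasurableSet A) :
    frechetIntensity {u | x⁻¹ * u ∈ A} = ENNReal.ofReal x⁻¹ * frechetIntensity A := by
  have hm : Measurable fun u : ℝ => x⁻¹ * u := measurable_const_mul _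
  have hmeas : Measurable ((Ioi (0 : ℝ) ∩ A).indicator fun u => ENNReal.ofReal (u ^ 2)⁻¹) :=
    Measurable.indicator (by fun_prop) (measurableSet_Ioi.inter hA)
  have hA' : MeasurableSet {u | x⁻¹ * u ∈ A} := hm hA
  rw [frechetIntensity_apply hA', frechetIntensity_apply hA]
  have h1 : ∀ u : ℝ, (Ioi 0 ∩ {u | x⁻¹ * u ∈ A}).indicator (fun u => ENNReal.ofReal (u ^ 2)⁻¹) u =
      ENNReal.ofReal (x⁻¹ ^ 2) *
        (Ioi 0 ∩ A).indicator (fun u => ENNReal.ofReal (u ^ 2)⁻¹) (x⁻¹ * u) := by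
    intro u
    have h2 : u ∈ Ioi (0 : ℝ) ∩ {u | x⁻¹ * u ∈ A} ↔ x⁻¹ * u ∈ Ioi (0 : ℝ) ∩ A := by
      simp [hx]
    by_cases hu : u ∈ Ioi (0 : ℝ) ∩ {u | x⁻¹ * u ∈ A}
    · rw [indicator_of_mem hu, indicator_of_mem (h2.1 hu), ← ENNReal.ofReal_mul (by positivity)]
      congr 1
      have : u ≠ 0 := ne_of_gt hu.1
      field_simp
    · rw [indicator_of_notMem hu, indicator_of_notMem (mt h2.2 hu), mul_zero]
  simp_rw [h1]
  rw [lintegral_const_mul' _ _ ENNReal.ofReal_ne_top,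
    ← lintegral_map (μ := volume) (g := fun u : ℝ => x⁻¹ * u) hmeas hm,
    Real.map_volume_mul_left (inv_ne_zero hx.ne'), lintegral_smul_measure, smul_eq_mul,
    ← mul_assoc, ← ENNReal.ofReal_mul (by positivity)]
  congr 2
  rw [inv_inv, abs_of_pos hx]
  field_simp

end Frechet

end M3

namespace M3

/-! ### The exponent measure of shifted shapes. -/

section ShiftedShape

variable {d : ℕ}

/-- The function `s ↦ u f(s - t)` on `C`, for a triple `(u, t, f)`. -/
noncomputable def shiftedShape (C : Set (EuclideanSpace ℝ (Fin d)))
    (p : ℝ × EuclideanSpace ℝ (Fin d) × NNCont (EuclideanSpace ℝ (Fin d))) : C(C, ℝ≥0) where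
  toFun s := p.1.toNNReal * p.2.2 (s - p.2.1)

lemma shiftedShape_apply (C : Set (EuclideanSpace ℝ (Fin d)))
    (p : ℝ × EuclideanSpace ℝ (Fin d) × NNCont (EuclideanSpace ℝ (Fin d))) (s : C) :
    shiftedShape C p s = p.1.toNNReal * p.2.2 (s - p.2.1) := rfl

lemma continuous_shiftedShape (C : Set (EuclideanSpace ℝ (Fin d))) :
    Continuous (shiftedShape C) := by
  refine ContinuousMap.continuous_of_continuous_uncurry _ ?_
  have h1 : Continuous fun q : (ℝ × EuclideanSpace ℝ (Fin d) ×
      NNCont (EuclideanSpace ℝ (Fin d))) × C => q.1.2.2 (q.2 - q.1.2.1) :=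
    ContinuousEval.continuous_eval.comp (f := fun q : (ℝ × EuclideanSpace ℝ (Fin d) ×
      NNCont (EuclideanSpace ℝ (Fin d))) × C => (q.1.2.2, (q.2 : EuclideanSpace ℝ (Fin d)) - q.1.2.1))
      (by fun_prop)
  exact (continuous_real_toNNReal.comp (continuous_fst.comp continuous_fst)).mul h1

lemma smul_shiftedShape (C : Set (EuclideanSpace ℝ (Fin d))) (x : ℝ≥0) (u : ℝ)
    (q : EuclideanSpace ℝ (Fin d) × NNCont (EuclideanSpace ℝ (Fin d))) :
    x • shiftedShape C (u, q) = shiftedShape C (x * u, q) := by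
  ext s
  simp only [ContinuousMap.smul_apply, shiftedShape_apply, smul_eq_mul,
    Real.toNNReal_mul x.coe_nonneg, Real.toNNReal_coe, mul_assoc]

/-- The intensity measure on `C(C)` of the Poisson point process of shifted shapes. -/
noncomputable def exponentMeasure {ΩF : Type*} [MeasurableSpace ΩF]
    (C : Set (EuclideanSpace ℝ (Fin d))) (F : ΩF → NNCont (EuclideanSpace ℝ (Fin d)))
    (PF : Measure ΩF) : Measure C(C, ℝ≥0) :=
  (frechetIntensity.prod (volume.prod (PF.map F))).map (shiftedShape C)

lemma exponentMeasure_apply {C : Set (EuclideanSpace ℝ (Fin d))} {ΩF : Type*} [MeasurableSpace ΩF]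
    {PF : Measure ΩF} [IsProbabilityMeasure PF] {F : ΩF → NNCont (EuclideanSpace ℝ (Fin d))}
    (hF : Measurable F) {A : Set C(C, ℝ≥0)} (hA : MeasurableSet A) :
    exponentMeasure C F PF A = ∫⁻ q, frechetIntensity {u | shiftedShape C (u, q) ∈ A}
      ∂(volume.prod (PF.map F)) := by
  have := Measure.isProbabilityMeasure_map (μ := PF) hF.aemeasurable
  have hm := (continuous_shiftedShape C).measurable
  rw [exponentMeasure, Measure.map_apply hm hA, Measure.prod_apply_symm (hm hA)]
  rfl

variable {C : Set (EuclideanSpace ℝ (Fin d))} [CompactSpace C]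

lemma dist_shiftedShape_zero (u : ℝ)
    (q : EuclideanSpace ℝ (Fin d) × NNCont (EuclideanSpace ℝ (Fin d))) :
    dist (shiftedShape C (u, q)) 0 = u.toNNReal * dist (shiftedShape C (1, q)) 0 := by
  rw [← dist_smul_zero, smul_shiftedShape]
  congr 1
  ext s
  simp [shiftedShape_apply]

/-- The integral of `max_{s ∈ C} F(s - t)` over `t` and `F`. -/
noncomputable def supIntegral {ΩF : Type*} [MeasurableSpace ΩF]
    (C : Set (EuclideanSpace ℝ (Fin d))) [CompactSpace C]
    (F : ΩF → NNCont (EuclideanSpace ℝ (Fin d))) (PF : Measure ΩF) : ℝ≥0∞ :=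
  ∫⁻ q, ENNReal.ofReal (dist (shiftedShape C (1, q)) 0) ∂(volume.prod (PF.map F))

variable {ΩF : Type*} [MeasurableSpace ΩF] {PF : Measure ΩF} [IsProbabilityMeasure PF]
  {F : ΩF → NNCont (EuclideanSpace ℝ (Fin d))}

lemma measurable_dist_shiftedShape_one :
    Measurable fun q : EuclideanSpace ℝ (Fin d) × NNCont (EuclideanSpace ℝ (Fin d)) =>
      dist (shiftedShape C (1, q)) 0 :=
  (continuous_dist_zero.comp ((continuous_shiftedShape C).comp
    (by fun_prop : Continuous fun q : EuclideanSpace ℝ (Fin d) ×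
      NNCont (EuclideanSpace ℝ (Fin d)) => ((1 : ℝ), q)))).measurable

lemma supIntegral_ne_top (hF : Measurable F)
    (hF_sup : ∫⁻ t, ∫⁻ ω, ⨆ t₀ ∈ C, (F ω (t₀ - t) : ℝ≥0∞) ∂PF ∂volume < ∞) :
    supIntegral C F PF ≠ ∞ := by
  have := Measure.isProbabilityMeasure_map (μ := PF) hF.aemeasurable
  have hm : Measurable fun q : EuclideanSpace ℝ (Fin d) × NNCont (EuclideanSpace ℝ (Fin d)) =>
      ENNReal.ofReal (dist (shiftedShape C (1, q)) 0) :=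
    measurable_dist_shiftedShape_one.ennreal_ofReal
  rw [supIntegral, lintegral_prod _ hm.aemeasurable]
  refine ne_top_of_le_ne_top hF_sup.ne (lintegral_mono fun t => ?_)
  have hmt : Measurable fun f : NNCont (EuclideanSpace ℝ (Fin d)) =>
      ENNReal.ofReal (dist (shiftedShape C (1, t, f)) 0) := hm.comp measurable_prodMk_left
  rw [lintegral_map hmt hF]
  refine lintegral_mono fun ω => ?_
  -- An infinite supremum is set apart because its `toReal` would be 0.
  by_cases htop : ⨆ t₀ ∈ C, (F ω (t₀ - t) : ℝ≥0∞) = ∞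
  · rw [htop]
    exact le_top
  refine ENNReal.ofReal_le_of_le_toReal ?_
  rw [dist_zero_le_iff ENNReal.toReal_nonneg]
  intro s
  rw [shiftedShape_apply, Real.toNNReal_one, one_mul]
  have h : (F ω (s - t) : ℝ≥0∞) ≤ ⨆ t₀ ∈ C, (F ω (t₀ - t) : ℝ≥0∞) :=
    le_iSup₂ (f := fun t₀ (_ : t₀ ∈ C) => (F ω (t₀ - t) : ℝ≥0∞)) s.1 s.2
  exact ENNReal.toReal_mono htop h

/-- The norm of a shifted shape is linear in `u > 0`. For a fixed shape of norm `s > 0` at `u = 1`,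
the level `y` is reached on a half-line starting at `y/s`, of mass `s/y`; integrating over shapes
gives the radial part. Scaling is inherited fibrewise from `u⁻² du`. -/
lemma isHomogeneousMeasure_exponentMeasure (hF : Measurable F)
    (hfin : supIntegral C F PF ≠ ∞) :
    IsHomogeneousMeasure (exponentMeasure C F PF) (supIntegral C F PF).toReal := by
  have hint : ∀ y : ℝ, 0 < y →
      ENNReal.ofReal ((supIntegral C F PF).toReal / y) =
        ∫⁻ q, ENNReal.ofReal (dist (shiftedShape C (1, q)) 0 / y) ∂(volume.prod (PF.map F)) := by
    intro y hy
    simp_rw [div_eq_mul_inv, ENNReal.ofReal_mul dist_nonneg]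
    rw [ENNReal.ofReal_mul ENNReal.toReal_nonneg, ENNReal.ofReal_toReal hfin,
      lintegral_mul_const' _ _ ENNReal.ofReal_ne_top, supIntegral]
  refine ⟨ENNReal.toReal_nonneg, fun y hy => ?_, fun y hy => ?_, fun x A hx hA => ?_⟩
  · rw [exponentMeasure_apply hF (measurableSet_le_dist_zero y), hint y hy]
    refine lintegral_congr fun q => ?_
    have hd := fun u => dist_shiftedShape_zero (C := C) u q
    have hs := dist_nonneg (x := shiftedShape C (1, q)) (y := 0)
    generalize dist (shiftedShape C (1, q)) 0 = s at hd hs ⊢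
    simp only [mem_ofPred_eq, hd]
    rcases hs.eq_or_lt' with hs | hs
    · simp [hs, hy.not_ge]
    · rw [← one_div_div, ← frechetIntensity_Ici (div_pos hy hs)]
      congr 1
      ext u
      rw [mem_ofPred_eq, mem_Ici, div_le_iff₀ hs, Real.coe_toNNReal', max_mul_of_nonneg _ _ hs.le,
        zero_mul, le_max_iff]
      simp [hy.not_ge]
  · rw [exponentMeasure_apply hF (measurableSet_lt_dist_zero y), hint y hy]
    refine lintegral_congr fun q => ?_
    have hd := fun u => dist_shiftedShape_zero (C := C) u q
    have hs := dist_nonneg (x := shiftedShape C (1, q)) (y := 0)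
    generalize dist (shiftedShape C (1, q)) 0 = s at hd hs ⊢
    simp only [mem_ofPred_eq, hd]
    rcases hs.eq_or_lt' with hs | hs
    · simp [hs, hy.not_gt]
    · rw [← one_div_div, ← frechetIntensity_Ioi (div_pos hy hs)]
      congr 1
      ext u
      rw [mem_ofPred_eq, mem_Ioi, div_lt_iff₀ hs, Real.coe_toNNReal', max_mul_of_nonneg _ _ hs.le,
        zero_mul, lt_max_iff]
      simp [hy.not_gt]
  · have hA' : MeasurableSet {g : C(C, ℝ≥0) | x⁻¹ • g ∈ A} :=
      (continuous_const_smul x⁻¹).measurable hA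
    have hx' : (0 : ℝ) < x := hx
    rw [exponentMeasure_apply hF hA', exponentMeasure_apply hF hA,
      ← lintegral_const_mul' _ _ ENNReal.coe_ne_top]
    refine lintegral_congr fun q => ?_
    have hm : MeasurableSet {u : ℝ | shiftedShape C (u, q) ∈ A} :=
      ((continuous_shiftedShape C).comp (by fun_prop : Continuous fun u : ℝ => (u, q))).measurable hA
    have h1 := frechetIntensity_preimage_mul hx' hm
    have h2 : ENNReal.ofReal (x : ℝ)⁻¹ = ((x⁻¹ : ℝ≥0) : ℝ≥0∞) := by
      rw [← NNReal.coe_inv, ENNReal.ofReal_coe_nnreal]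
    rw [← h2, ← h1]
    congr 1
    ext u
    simp only [mem_ofPred_eq, smul_shiftedShape, NNReal.coe_inv]

end ShiftedShape

/-! ### Restriction of the limit process to a compact set. -/

section MovingMaxima

variable {d : ℕ} {C : Set (EuclideanSpace ℝ (Fin d))} [CompactSpace C]
  {ΩF : Type*} [MeasurableSpace ΩF] {PF : Measure ΩF}
  {F : ΩF → NNCont (EuclideanSpace ℝ (Fin d))}
  {ΩM : Type*} [MeasurableSpace ΩM] {PM : Measure ΩM} [IsProbabilityMeasure PM]
  {M : ΩM → NNCont (EuclideanSpace ℝ (Fin d))}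

/-- Points are pushed forward by `shiftedShape`; counts in `A` are counts of the original process in
the preimage of `A`. -/
lemma IsMixedMovingMaxima.exists_isPoissonSup (hM : IsMixedMovingMaxima M PM F PF) :
    ∃ Y : ℕ → ΩM → C(C, ℝ≥0),
      IsPoissonSup (fun ω => (M ω).restrict C) Y (exponentMeasure C F PF) PM := by
  obtain ⟨X, hX, hMX⟩ := hM
  have hm := (continuous_shiftedShape C).measurable
  refine ⟨fun i ω => shiftedShape C (X i ω), fun A hA hfin => ?_, fun A hA hfin => ?_, ?_⟩
  · rw [exponentMeasure, Measure.map_apply hm hA] at hfin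
    rw [exponentMeasure, map_measureReal_apply hm hA]
    exact hX.real_exists_mem (hm hA) hfin
  · rw [exponentMeasure, Measure.map_apply hm hA] at hfin
    rw [exponentMeasure, map_measureReal_apply hm hA]
    exact hX.real_two_mem_le (hm hA) hfin
  · filter_upwards [hMX] with ω hω t
    have h := hω t
    simp only [ContinuousMap.restrict_apply, shiftedShape_apply, ENNReal.coe_mul]
    exact h

lemma InMaxDomainOfAttraction.tendsto_restrict {Ω : Type*} [MeasurableSpace Ω] {P : Measure Ω}
    [IsProbabilityMeasure P] {η : Ω → NNCont (EuclideanSpace ℝ (Fin d))}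
    (h : InMaxDomainOfAttraction η P M PM) (C : Set (EuclideanSpace ℝ (Fin d))) :
    TendstoInDistribution
      (fun (n : ℕ) (ω : Fin n → Ω) => scaledMax n fun i => (η (ω i)).restrict C)
      atTop (fun ω => (M ω).restrict C) (fun n => Measure.pi fun _ : Fin n => P) PM :=
  TendstoInDistribution.continuous_comp (ContinuousMap.continuous_restrict C) h

end MovingMaxima

end M3

namespace M3

/-! ### Existence and scale invariance of the lexicographic argmax. -/

section LexMin

variable {d : ℕ}

/-- A nonempty compact set has a lexicographically smallest point. -/
lemma exists_lex_min {A : Set (EuclideanSpace ℝ (Fin d))} (hA : IsCompact A) (hne : A.Nonempty) :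
    ∃ t ∈ A, ∀ s ∈ A, toLex (fun i => t i) ≤ toLex (fun i => s i) := by
  -- Coordinates are minimized one after another. After `k` steps, the points of `A'` share their
  -- first `k` coordinates and precede lexicographically every point of `A` that was discarded.
  have key : ∀ k ≤ d, ∃ A' ⊆ A, IsCompact A' ∧ A'.Nonempty ∧
      (∀ t ∈ A', ∀ s ∈ A, s ∈ A' ∨ ∃ j : Fin d, (∀ i < j, t i = s i) ∧ t j < s j) ∧
      ∀ t ∈ A', ∀ s ∈ A', ∀ i : Fin d, i.1 < k → t i = s i := by
    intro k
    induction k with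
    | zero => exact fun _ => ⟨A, Subset.rfl, hA, hne, fun _ _ s hs => Or.inl hs, by simp⟩
    | succ k ih =>
      intro hk
      obtain ⟨A', hsub, hcomp, hne', hlex, heq⟩ := ih (by omega)
      let j : Fin d := ⟨k, hk⟩
      have hcont : Continuous fun t : EuclideanSpace ℝ (Fin d) => t j := by fun_prop
      obtain ⟨t₀, ht₀, hmin⟩ := hcomp.exists_isMinOn hne' hcont.continuousOn
      refine ⟨A' ∩ {t | t j ≤ t₀ j}, inter_subset_left.trans hsub,
        hcomp.inter_right (isClosed_le hcont continuous_const), ⟨t₀, ht₀, le_refl (t₀ j)⟩, ?_, ?_⟩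
      · rintro t ⟨ht, htj⟩ s hs
        rcases hlex t ht s hs with h | h
        · by_cases hsj : s j ≤ t₀ j
          · exact Or.inl ⟨h, hsj⟩
          · refine Or.inr ⟨j, fun i hi => heq t ht s h i hi, ?_⟩
            exact lt_of_le_of_lt htj (not_le.1 hsj)
        · exact Or.inr h
      · rintro t ⟨ht, htj⟩ s ⟨hs, hsj⟩ i hi
        rcases Nat.lt_succ_iff_lt_or_eq.1 hi with h | h
        · exact heq t ht s hs i h
        · have : i = j := Fin.ext h
          subst this
          exact le_antisymm (le_trans htj (hmin hs)) (le_trans hsj (hmin ht))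
  obtain ⟨A', hsub, -, ⟨t, ht⟩, hlex, heq⟩ := key d le_rfl
  refine ⟨t, hsub ht, fun s hs => ?_⟩
  rcases hlex t ht s hs with h | ⟨j, hj1, hj2⟩
  · exact le_of_eq (congrArg toLex (funext fun i => heq t ht s h i i.2))
  · exact le_of_lt ⟨j, hj1, hj2⟩

variable {Q : Set (EuclideanSpace ℝ (Fin d))}

lemma tau_mem_argmaxOn (hQ : IsCompact Q) (hne : Q.Nonempty)
    (f : NNCont (EuclideanSpace ℝ (Fin d))) : tau Q f ∈ argmaxOn Q f := by
  have h : ∃ t ∈ argmaxOn Q f, ∀ s ∈ argmaxOn Q f,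
      toLex (fun i => t i) ≤ toLex (fun i => s i) := by
    obtain ⟨t, ht, hmax⟩ := hQ.exists_isMaxOn hne f.continuous.continuousOn
    have heq : argmaxOn Q f = Q ∩ {s | f t ≤ f s} := by
      ext s
      exact ⟨fun h => ⟨h.1, h.2 t ht⟩, fun h => ⟨h.1, fun q hq => (hmax hq).trans h.2⟩⟩
    have hcomp : IsCompact (argmaxOn Q f) := by
      rw [heq]
      exact hQ.inter_right (isClosed_le continuous_const f.continuous)
    exact exists_lex_min hcomp ⟨t, ht, fun s hs => hmax hs⟩
  rw [tau, dif_pos h]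
  exact h.choose_spec.1

open Classical in
lemma tau_smul {c : ℝ≥0} (hc : 0 < c) (f : NNCont (EuclideanSpace ℝ (Fin d))) :
    tau Q (c • f : NNCont _) = tau Q f := by
  have h : argmaxOn Q (c • f : NNCont _) = argmaxOn Q f := by
    ext t
    simp [argmaxOn, hc]
  exact congrArg (fun S : Set (EuclideanSpace ℝ (Fin d)) =>
    if h : ∃ t ∈ S, ∀ s ∈ S, toLex (fun i => t i) ≤ toLex (fun i => s i) then h.choose else 0) h

end LexMin

/-! ### Stability of maximizers and of normalized windows under uniform convergence. -/

section Peaks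

variable {E : Type*} [TopologicalSpace E]

/-- By continuity, `h` takes the value `h t` at any cluster point of `s`, so uniqueness of the
maximizer identifies that point with `t`; compactness then gives convergence. -/
lemma tendsto_of_tendsto_max {C : Set E} (hC : IsCompact C) {h : NNCont E} {t : E}
    (hmax : ∀ s, s ≠ t → h s < h t) {s : ℕ → E} (hs : ∀ k, s k ∈ C)
    (hlim : Tendsto (fun k => h (s k)) atTop (𝓝 (h t))) : Tendsto s atTop (𝓝 t) := by
  refine hC.tendsto_nhds_of_unique_mapClusterPt (Eventually.of_forall hs) fun y _ hy => ?_
  by_contra hne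
  have h1 : MapClusterPt (h y) atTop (fun k => h (s k)) :=
    hy.continuousAt_comp h.continuous.continuousAt
  have h2 : h y = h t := by
    have := h1.clusterPt
    exact eq_of_nhds_neBot (ClusterPt.mono this hlim)
  exact (hmax y hne).ne h2

/-- Maximizers of functions converging uniformly to a function with a unique maximizer. -/
lemma tendsto_of_restrict_tendsto {C : Set E} [CompactSpace C] {h : NNCont E} {t : E}
    (hmax : ∀ s, s ≠ t → h s < h t) (ht : t ∈ C) {f : ℕ → NNCont E}
    (hf : Tendsto (fun k => (f k).restrict C) atTop (𝓝 (h.restrict C))) {s : ℕ → E}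
    (hs : ∀ k, s k ∈ C) (hfs : ∀ k, f k t ≤ f k (s k)) :
    Tendsto s atTop (𝓝 t) ∧ Tendsto (fun k => f k (s k)) atTop (𝓝 (h t)) := by
  have hd := tendsto_iff_dist_tendsto_zero.1 hf
  have happ : ∀ k, ∀ y ∈ C, |(f k y : ℝ) - h y| ≤ dist ((f k).restrict C) (h.restrict C) := by
    intro k y hy
    have := ContinuousMap.dist_apply_le_dist (f := (f k).restrict C) (g := h.restrict C) ⟨y, hy⟩
    rwa [NNReal.dist_eq] at this
  have hle : ∀ k, (h (s k) : ℝ) ≤ h t := fun k => by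
    by_cases hk : s k = t
    · rw [hk]
    · exact_mod_cast (hmax _ hk).le
  have h1 : ∀ k, (h t : ℝ) - 2 * dist ((f k).restrict C) (h.restrict C) ≤ h (s k) := fun k => by
    have h2 := abs_le.1 (happ k t ht)
    have h3 := abs_le.1 (happ k (s k) (hs k))
    have h4 : (f k t : ℝ) ≤ f k (s k) := hfs k
    linarith [h2.1, h3.2]
  have h2 : Tendsto (fun k => (h (s k) : ℝ)) atTop (𝓝 (h t)) := by
    refine tendsto_of_tendsto_of_tendsto_of_le_of_le ?_ tendsto_const_nhds h1 hle
    simpa using (hd.const_mul 2).const_sub (h t : ℝ)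
  refine ⟨tendsto_of_tendsto_max (isCompact_iff_compactSpace.2 inferInstance) hmax hs
    (NNReal.tendsto_coe.1 h2), NNReal.tendsto_coe.1 ?_⟩
  have h3 : Tendsto (fun k => (f k (s k) : ℝ) - h (s k)) atTop (𝓝 0) :=
    squeeze_zero_norm (fun k => happ k (s k) (hs k)) hd
  simpa using h3.add h2

end Peaks

section Window

variable {d : ℕ} {C K : Set (EuclideanSpace ℝ (Fin d))}

/-- The function `v ↦ f(s + v)` on `K`. -/
def translate (K : Set (EuclideanSpace ℝ (Fin d))) (f : NNCont (EuclideanSpace ℝ (Fin d)))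
    (s : EuclideanSpace ℝ (Fin d)) : C(K, ℝ≥0) where
  toFun v := f (s + v)

lemma window_eq_smul (f : NNCont (EuclideanSpace ℝ (Fin d))) (s : EuclideanSpace ℝ (Fin d))
    (c : ℝ≥0) : window K f s c = c⁻¹ • translate K f s := by
  ext v
  simp [window, translate, div_eq_inv_mul]

lemma continuous_translate (f : NNCont (EuclideanSpace ℝ (Fin d))) :
    Continuous (translate K f) := by
  refine ContinuousMap.continuous_of_continuous_uncurry _ ?_
  change Continuous fun q : EuclideanSpace ℝ (Fin d) × K => f (q.1 + q.2)
  fun_prop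

lemma tendsto_window [CompactSpace C] [CompactSpace K] {h : NNCont (EuclideanSpace ℝ (Fin d))}
    {f : ℕ → NNCont (EuclideanSpace ℝ (Fin d))} {t : EuclideanSpace ℝ (Fin d)}
    (hf : Tendsto (fun k => (f k).restrict C) atTop (𝓝 (h.restrict C)))
    {s : ℕ → EuclideanSpace ℝ (Fin d)} (hsK : ∀ k, ∀ v ∈ K, s k + v ∈ C)
    (hs : Tendsto s atTop (𝓝 t)) {c : ℕ → ℝ≥0} {c' : ℝ≥0} (hc : Tendsto c atTop (𝓝 c'))
    (hc' : c' ≠ 0) :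
    Tendsto (fun k => window K (f k) (s k) (c k)) atTop (𝓝 (window K h t c')) := by
  simp_rw [window_eq_smul]
  refine (hc.inv₀ hc').smul ?_
  have h1 : Tendsto (fun k => translate K h (s k)) atTop (𝓝 (translate K h t)) :=
    ((continuous_translate h).tendsto t).comp hs
  refine tendsto_of_tendsto_of_dist h1 (squeeze_zero (fun _ => dist_nonneg) (fun k => ?_)
    (tendsto_iff_dist_tendsto_zero.1 hf))
  rw [ContinuousMap.dist_le dist_nonneg]
  intro v
  rw [dist_comm]
  exact ContinuousMap.dist_apply_le_dist (f := (f k).restrict C) (g := h.restrict C)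
    ⟨s k + v, hsK k v v.2⟩

end Window

section Maximum

variable {E : Type*} [TopologicalSpace E]

lemma coe_sSup_image {C : Set E} [CompactSpace C] (hne : C.Nonempty) (f : NNCont E) :
    ((sSup (f '' C) : ℝ≥0) : ℝ) = dist (f.restrict C) 0 := by
  have hC : IsCompact C := isCompact_iff_compactSpace.2 inferInstance
  obtain ⟨t, ht, hmax⟩ := hC.exists_isMaxOn hne f.continuous.continuousOn
  have h1 : IsGreatest (f '' C) (f t) := ⟨mem_image_of_mem _ ht, by
    rintro _ ⟨s, hs, rfl⟩
    exact hmax hs⟩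
  rw [h1.csSup_eq]
  refine le_antisymm (apply_le_dist_zero (f.restrict C) ⟨t, ht⟩) ?_
  rw [dist_zero_le_iff (NNReal.coe_nonneg _)]
  exact fun s => hmax s.2

end Maximum

end M3

namespace M3

variable {d : ℕ}

/-! ### Closures of the peak and off-peak sets. -/

/-- Functions whose maximum over `Q ⊕ L` is at least `1` and attained at `τ_Q`, and whose
normalized shape around `τ_Q` lies in `B`. -/
def peakShapes (Q L K : Set (EuclideanSpace ℝ (Fin d))) (B : Set (NNCont K)) :
    Set (NNCont (EuclideanSpace ℝ (Fin d))) :=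
  {f | (∀ s ∈ Q + L, f s ≤ f (tau Q f)) ∧ 1 ≤ f (tau Q f) ∧
    window K f (tau Q f) (f (tau Q f)) ∈ B}

/-- Functions whose maximum over `Q ⊕ L` is at least `1` and larger than the maximum over `Q`. -/
def offPeakShapes (Q L : Set (EuclideanSpace ℝ (Fin d))) :
    Set (NNCont (EuclideanSpace ℝ (Fin d))) :=
  {f | ∃ s ∈ Q + L, (∀ y ∈ Q + L, f y ≤ f s) ∧ 1 ≤ f s ∧ ∀ y ∈ Q, f y < f s}

section Closures

variable {Q L K : Set (EuclideanSpace ℝ (Fin d))} {C : Set (EuclideanSpace ℝ (Fin d))}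
  [CompactSpace C] {h : NNCont (EuclideanSpace ℝ (Fin d))} {t : EuclideanSpace ℝ (Fin d)}

omit [CompactSpace C] in
lemma one_le_dist_of_mem_closure {A : Set (NNCont (EuclideanSpace ℝ (Fin d)))}
    {C' : Set (EuclideanSpace ℝ (Fin d))} [CompactSpace C'] (hC' : C' ⊆ C)
    (hA : ∀ f ∈ A, ∃ s ∈ C', 1 ≤ f s)
    (hh : h.restrict C ∈ closure ((fun f => f.restrict C) '' A)) : 1 ≤ dist (h.restrict C') 0 := by
  let ι : C(C', C) := ⟨inclusion hC', continuous_inclusion hC'⟩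
  have hcl : IsClosed {g : C(C, ℝ≥0) | 1 ≤ dist (g.comp ι) 0} :=
    isClosed_le continuous_const
      (continuous_dist_zero.comp (ContinuousMap.continuous_precomp ι))
  have hι : ∀ f : NNCont (EuclideanSpace ℝ (Fin d)), (f.restrict C).comp ι = f.restrict C' :=
    fun f => rfl
  have hsub : (fun f => f.restrict C) '' A ⊆ {g : C(C, ℝ≥0) | 1 ≤ dist (g.comp ι) 0} := by
    rintro _ ⟨f, hf, rfl⟩
    obtain ⟨s, hs, h1⟩ := hA f hf
    have h2 := apply_le_dist_zero (f.restrict C') ⟨s, hs⟩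
    have h3 : (1 : ℝ) ≤ f s := h1
    rw [mem_ofPred_eq, hι]
    exact h3.trans h2
  have h4 := closure_minimal hsub hcl hh
  rwa [mem_ofPred_eq, hι] at h4

/-- Although `tau` is discontinuous in general, along approximating peak functions it converges to
the unique maximizer `t` of `h`, and the windows converge with it. The assumption `t ∈ Q + L` is
what allows `f k t` to be compared with the peak value. -/
lemma of_mem_closure_peakShapes [CompactSpace K] (hQ : IsCompact Q) (hne : Q.Nonempty)
    (hQL : Q + L ⊆ C) (hQK : Q + K ⊆ C) (hQC : Q ⊆ C) {B : Set (NNCont K)}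
    (hmax : ∀ s, s ≠ t → h s < h t) (ht : t ∈ Q + L)
    (hh : h.restrict C ∈ closure ((fun f => f.restrict C) '' peakShapes Q L K B)) :
    t ∈ Q ∧ 1 ≤ h t ∧ window K h t (h t) ∈ closure B := by
  obtain ⟨g, hg, hlim⟩ := mem_closure_iff_seq_limit.1 hh
  choose f hf hfg using hg
  have hlim : Tendsto (fun k => (f k).restrict C) atTop (𝓝 (h.restrict C)) := by
    simpa only [hfg] using hlim
  have htau : ∀ k, tau Q (f k) ∈ Q := fun k => (tau_mem_argmaxOn hQ hne (f k)).1
  obtain ⟨h1, h2⟩ := tendsto_of_restrict_tendsto hmax (hQL ht) hlim (s := fun k => tau Q (f k))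
    (fun k => hQC (htau k)) fun k => (hf k).1 t ht
  have h3 : 1 ≤ h t := ge_of_tendsto' h2 fun k => (hf k).2.1
  refine ⟨hQ.isClosed.mem_of_tendsto h1 (Eventually.of_forall htau), h3, ?_⟩
  refine mem_closure_of_tendsto (tendsto_window hlim (fun k v hv => hQK ?_) h1 h2
    (zero_lt_one.trans_le h3).ne') (Eventually.of_forall fun k => (hf k).2.2)
  exact add_mem_add (htau k) hv

/-- Maximizers of the approximating functions lie outside `Q` and converge to `t`. The limit may
still fall on the boundary of `Q`, which is why only the interior is excluded. -/
lemma notMem_interior_of_mem_closure_offPeakShapes (hC : C = Q + L) (hQC : Q ⊆ C)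
    (hmax : ∀ s, s ≠ t → h s < h t)
    (hh : h.restrict C ∈ closure ((fun f => f.restrict C) '' offPeakShapes Q L)) :
    t ∉ interior Q := by
  intro ht
  obtain ⟨g, hg, hlim⟩ := mem_closure_iff_seq_limit.1 hh
  choose f hf hfg using hg
  have hlim : Tendsto (fun k => (f k).restrict C) atTop (𝓝 (h.restrict C)) := by
    simpa only [hfg] using hlim
  choose s hs1 hs2 hs3 hs4 using hf
  have htC : t ∈ C := hQC (interior_subset ht)
  obtain ⟨h1, -⟩ := tendsto_of_restrict_tendsto hmax htC hlim (s := s)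
    (fun k => hC ▸ hs1 k) fun k => hs2 k t (hC ▸ htC)
  obtain ⟨k, hk⟩ := (h1.eventually (isOpen_interior.mem_nhds ht)).exists
  exact lt_irrefl _ (hs4 k (s k) (interior_subset hk))

end Closures

/-! ### Rescaled peak events lie in the closed test sets. -/

section Rescaling

variable {Ω : Type*} {η : Ω → NNCont (EuclideanSpace ℝ (Fin d))}
  {Q L K : Set (EuclideanSpace ℝ (Fin d))}

lemma apply_le_sSup_image {C : Set (EuclideanSpace ℝ (Fin d))} (hC : IsCompact C)
    (f : NNCont (EuclideanSpace ℝ (Fin d))) {s : EuclideanSpace ℝ (Fin d)} (hs : s ∈ C) :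
    f s ≤ sSup (f '' C) :=
  le_csSup (hC.image f.continuous).bddAbove (mem_image_of_mem _ hs)

lemma apply_tau_eq_sSup (hQ : IsCompact Q) (hne : Q.Nonempty)
    (f : NNCont (EuclideanSpace ℝ (Fin d))) : f (tau Q f) = sSup (f '' Q) := by
  obtain ⟨h1, h2⟩ := tau_mem_argmaxOn hQ hne f
  refine le_antisymm (apply_le_sSup_image hQ f h1) (csSup_le (hne.image _) ?_)
  rintro _ ⟨s, hs, rfl⟩
  exact h2 s hs

/-- Location and normalized shape of a peak are invariant under scaling, and the height condition
only relaxes when dividing by `b ≤ a`. This supplies the hypothesis `hS` of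
`eventually_mul_real_le`. -/
lemma smul_mem_peakShapes (hQ : IsCompact Q) (hL : IsCompact L) (hne : Q.Nonempty)
    {B : Set (NNCont K)} {a : ℝ} {b : ℝ≥0} (hb : 0 < b) (hba : b ≤ a) {ω : Ω}
    (hω : ω ∈ peakEvent η Q L a ∩ shapeEvent η Q K B) :
    (b⁻¹ • η ω : NNCont _) ∈ peakShapes Q L K B := by
  obtain ⟨⟨h1, h2⟩, h3⟩ := hω
  have hb' : 0 < b⁻¹ := inv_pos.2 hb
  have htau := apply_tau_eq_sSup hQ hne (η ω)
  rw [← htau] at h1 h2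
  have hbt : b ≤ η ω (tau Q (η ω)) := by exact_mod_cast hba.trans h2
  refine ⟨fun s hs => ?_, ?_, ?_⟩
  · rw [tau_smul hb', ContinuousMap.smul_apply, ContinuousMap.smul_apply, h1]
    exact mul_le_mul_right (apply_le_sSup_image (hQ.add hL) _ hs) _
  · rw [tau_smul hb', ContinuousMap.smul_apply, smul_eq_mul, ← div_eq_inv_mul, one_le_div hb]
    exact hbt
  · rw [tau_smul hb']
    have h4 : window K (b⁻¹ • η ω : NNCont _) (tau Q (η ω)) ((b⁻¹ • η ω : NNCont _) (tau Q (η ω))) =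
        window K (η ω) (tau Q (η ω)) (η ω (tau Q (η ω))) := by
      ext v
      simp only [window, ContinuousMap.coe_mk, ContinuousMap.smul_apply, smul_eq_mul]
      rw [mul_div_mul_left _ _ hb'.ne']
    rw [h4]
    exact h3

lemma smul_mem_offPeakShapes (hQ : IsCompact Q) (hL : IsCompact L) (hne : Q.Nonempty)
    (hL0 : 0 ∈ L) {a : ℝ} {b : ℝ≥0} (hb : 0 < b) (hba : b ≤ a) {ω : Ω}
    (hω : a ≤ (sSup (η ω '' (Q + L)) : ℝ≥0)) (hω' : ω ∉ peakEvent η Q L a) :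
    (b⁻¹ • η ω : NNCont _) ∈ offPeakShapes Q L := by
  have hb' : 0 < b⁻¹ := inv_pos.2 hb
  have hcomp := hQ.add hL
  have hQL : Q ⊆ Q + L := fun q hq => by simpa using add_mem_add hq hL0
  obtain ⟨s, hs, hmax⟩ := hcomp.exists_isMaxOn (hne.mono hQL) (η ω).continuous.continuousOn
  have hs' : sSup (η ω '' (Q + L)) = η ω s := by
    refine le_antisymm (csSup_le ((hne.mono hQL).image _) ?_) (apply_le_sSup_image hcomp _ hs)
    rintro _ ⟨y, hy, rfl⟩
    exact hmax hy
  rw [hs'] at hω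
  have hbs : b ≤ η ω s := by exact_mod_cast hba.trans hω
  refine ⟨s, hs, fun y hy => ?_, ?_, fun y hy => ?_⟩
  · exact mul_le_mul_right (hmax hy) _
  · rw [ContinuousMap.smul_apply, smul_eq_mul, ← div_eq_inv_mul, one_le_div hb]
    exact hbs
  · refine mul_lt_mul_of_pos_left (lt_of_le_of_ne (hmax (hQL hy)) fun heq => hω' ?_) hb'
    have h1 : sSup (η ω '' Q) = η ω s := by
      refine le_antisymm ?_ (heq ▸ apply_le_sSup_image hQ _ hy)
      rw [← hs']
      exact csSup_le_csSup (hcomp.image (η ω).continuous).bddAbove (hne.image _) (image_mono hQL)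
    exact ⟨h1.trans hs'.symm, h1 ▸ hω⟩

end Rescaling

end M3

namespace M3

/-! ### Exponent measures of the peak and off-peak sets. -/

section Intensity

variable {d : ℕ} {ΩF : Type*} [MeasurableSpace ΩF] {PF : Measure ΩF} [IsProbabilityMeasure PF]
  {F : ΩF → NNCont (EuclideanSpace ℝ (Fin d))} {lam : ℝ≥0}

/-- The function `s ↦ u f(s - t)`, for a triple `(u, t, f)`. -/
noncomputable def shiftedFun
    (p : ℝ × EuclideanSpace ℝ (Fin d) × NNCont (EuclideanSpace ℝ (Fin d))) :
    NNCont (EuclideanSpace ℝ (Fin d)) where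
  toFun s := p.1.toNNReal * p.2.2 (s - p.2.1)

lemma shiftedFun_self (u : ℝ) (t : EuclideanSpace ℝ (Fin d))
    (f : NNCont (EuclideanSpace ℝ (Fin d))) : shiftedFun (u, t, f) t = u.toNNReal * f 0 := by
  simp [shiftedFun]

lemma shiftedFun_lt {u : ℝ} (hu : 0 < u) {f : NNCont (EuclideanSpace ℝ (Fin d))}
    (hf : ∀ t, t ≠ 0 → f t < f 0) (t s : EuclideanSpace ℝ (Fin d)) (hs : s ≠ t) :
    shiftedFun (u, t, f) s < shiftedFun (u, t, f) t := by
  rw [shiftedFun_self]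
  exact mul_lt_mul_of_pos_left (hf _ (sub_ne_zero.2 hs)) (Real.toNNReal_pos.2 hu)

lemma window_shiftedFun {u : ℝ} (hu : 0 < u) (t : EuclideanSpace ℝ (Fin d))
    (f : NNCont (EuclideanSpace ℝ (Fin d))) (K : Set (EuclideanSpace ℝ (Fin d))) :
    window K (shiftedFun (u, t, f)) t (shiftedFun (u, t, f) t) = window K f 0 (f 0) := by
  ext v
  rw [shiftedFun_self]
  have hu' := (Real.toNNReal_pos.2 hu).ne'
  simp only [window, shiftedFun, ContinuousMap.coe_mk, add_sub_cancel_left, zero_add]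
  rw [mul_div_mul_left _ _ hu']

/-- The intensity measure of the Poisson point process, with shapes indexed by `ΩF`. -/
noncomputable def shapeIntensity (d : ℕ) (PF : Measure ΩF) :
    Measure (ℝ × EuclideanSpace ℝ (Fin d) × ΩF) :=
  frechetIntensity.prod (volume.prod PF)

lemma continuous_shiftedShape_measurable (C : Set (EuclideanSpace ℝ (Fin d)))
    (hF : Measurable F) : Measurable fun p : ℝ × EuclideanSpace ℝ (Fin d) × ΩF =>
      shiftedShape C (p.1, p.2.1, F p.2.2) :=
  (continuous_shiftedShape C).measurable.comp (by fun_prop)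

/-- Replacing the law of `F` by the underlying space `ΩF` lets the almost sure properties of `F` be
used pointwise in `ω`. -/
lemma exponentMeasure_eq_shapeIntensity (hF : Measurable F)
    {C : Set (EuclideanSpace ℝ (Fin d))} {A : Set C(C, ℝ≥0)} (hA : MeasurableSet A) :
    exponentMeasure C F PF A =
      shapeIntensity d PF {p | shiftedShape C (p.1, p.2.1, F p.2.2) ∈ A} := by
  have := Measure.isProbabilityMeasure_map (μ := PF) hF.aemeasurable
  have hm := (continuous_shiftedShape C).measurable
  have h1 : (volume : Measure (EuclideanSpace ℝ (Fin d))).prod (PF.map F) =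
      (volume.prod PF).map (Prod.map id F) := by
    rw [← Measure.map_prod_map _ _ measurable_id hF, Measure.map_id]
  have h2 : frechetIntensity.prod ((volume : Measure (EuclideanSpace ℝ (Fin d))).prod (PF.map F)) =
      (shapeIntensity d PF).map (Prod.map id (Prod.map id F)) := by
    have hm' : Measurable (Prod.map id F : EuclideanSpace ℝ (Fin d) × ΩF → _) :=
      measurable_id.prodMap hF
    rw [shapeIntensity, ← Measure.map_prod_map _ _ measurable_id hm', Measure.map_id, h1]
  rw [exponentMeasure, h2, Measure.map_map hm (by fun_prop), Measure.map_apply (by fun_prop) hA]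
  rfl

omit [IsProbabilityMeasure PF] in
lemma ae_shapeIntensity [SFinite PF] {p : ΩF → Prop} (h : ∀ᵐ ω ∂PF, p ω) :
    ∀ᵐ x ∂(shapeIntensity d PF), p x.2.2 :=
  (Measure.quasiMeasurePreserving_snd.comp Measure.quasiMeasurePreserving_snd).ae h

lemma frechetIntensity_level (hlam : 0 < lam) :
    frechetIntensity {u | 1 ≤ u.toNNReal * lam} = lam := by
  have hlam' : (0 : ℝ) < lam := hlam
  have h1 : {u : ℝ | 1 ≤ u.toNNReal * lam} = Ici (1 / (lam : ℝ)) := by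
    ext u
    rw [mem_Ici, div_le_iff₀ hlam', mem_ofPred_eq, ← NNReal.coe_le_coe, NNReal.coe_mul,
      Real.coe_toNNReal', max_mul_of_nonneg _ _ hlam'.le, zero_mul, NNReal.coe_one, le_max_iff]
    simp [zero_lt_one.not_ge]
  rw [h1, frechetIntensity_Ici (by positivity), one_div_one_div, ENNReal.ofReal_coe_nnreal]

variable {Q L K : Set (EuclideanSpace ℝ (Fin d))}

/-- Points outside `Q ⊕ L` whose shapes exceed the level `1` on `Q`. -/
def remoteExceedances (Q L : Set (EuclideanSpace ℝ (Fin d))) [CompactSpace Q]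
    (F : ΩF → NNCont (EuclideanSpace ℝ (Fin d))) : Set (ℝ × EuclideanSpace ℝ (Fin d) × ΩF) :=
  {p | p.2.1 ∉ Q + L ∧ 1 ≤ dist (shiftedShape Q (p.1, p.2.1, F p.2.2)) 0}

lemma pos_of_one_le_dist {C : Set (EuclideanSpace ℝ (Fin d))} [CompactSpace C] {u : ℝ}
    {q : EuclideanSpace ℝ (Fin d) × NNCont (EuclideanSpace ℝ (Fin d))}
    (h : 1 ≤ dist (shiftedShape C (u, q)) 0) : 0 < u := by
  by_contra hu
  rw [dist_shiftedShape_zero, Real.toNNReal_of_nonpos (not_lt.1 hu)] at h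
  norm_num at h

lemma exponentMeasure_peakShapes_le (hF : Measurable F) (hlam : 0 < lam)
    (hF_max : ∀ᵐ ω ∂PF, F ω 0 = lam ∧ ∀ t, t ≠ 0 → F ω t < lam)
    [CompactSpace Q] [CompactSpace K] (hne : Q.Nonempty)
    {C : Set (EuclideanSpace ℝ (Fin d))} [CompactSpace C] (hQC : Q ⊆ C) (hQL : Q + L ⊆ C)
    (hQK : Q + K ⊆ C) (B : Set (NNCont K)) :
    exponentMeasure C F PF (closure ((fun f => f.restrict C) '' peakShapes Q L K B)) ≤
      lam * (volume Q * PF {ω | window K (F ω) 0 lam ∈ closure B}) +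
        shapeIntensity d PF (remoteExceedances Q L F) := by
  have hQ : IsCompact Q := isCompact_iff_compactSpace.2 inferInstance
  rw [exponentMeasure_eq_shapeIntensity hF isClosed_closure.measurableSet]
  have hrect : shapeIntensity d PF ({u | 1 ≤ u.toNNReal * lam} ×ˢ
      (Q ×ˢ {ω | window K (F ω) 0 lam ∈ closure B})) =
        lam * (volume Q * PF {ω | window K (F ω) 0 lam ∈ closure B}) := by
    rw [shapeIntensity, Measure.prod_prod, Measure.prod_prod, frechetIntensity_level hlam]
  rw [← hrect]
  refine (measure_mono_ae ?_).trans (measure_union_le _ _)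
  filter_upwards [ae_shapeIntensity hF_max] with ⟨u, t, ω⟩ ⟨hω0, hω⟩ hp
  simp only at hω0 hω
  have hp : (shiftedFun (u, t, F ω)).restrict C ∈
    closure ((fun f => f.restrict C) '' peakShapes Q L K B) := hp
  have h1 : 1 ≤ dist ((shiftedFun (u, t, F ω)).restrict Q) 0 :=
    one_le_dist_of_mem_closure hQC
      (fun f hf => ⟨tau Q f, (tau_mem_argmaxOn hQ hne f).1, hf.2.1⟩) hp
  -- For `t` outside `Q + L` the peak condition says nothing about the value at `t`, so such points
  -- are only known to reach level 1 on `Q` and are counted as remote.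
  by_cases ht : t ∈ Q + L
  · have hu := pos_of_one_le_dist h1
    left
    have h2 := of_mem_closure_peakShapes hQ hne hQL hQK hQC
      (shiftedFun_lt hu (fun s hs => hω0 ▸ hω s hs) t) ht hp
    rw [window_shiftedFun hu, shiftedFun_self, hω0] at h2
    exact ⟨h2.2.1, h2.1, h2.2.2⟩
  · exact Or.inr ⟨ht, h1⟩

lemma exponentMeasure_offPeakShapes_add_le (hF : Measurable F) (hlam : 0 < lam)
    (hF_max : ∀ᵐ ω ∂PF, F ω 0 = lam ∧ ∀ t, t ≠ 0 → F ω t < lam)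
    {C : Set (EuclideanSpace ℝ (Fin d))} [CompactSpace C] (hC : C = Q + L) (hQC : Q ⊆ C) :
    exponentMeasure C F PF (closure ((fun f => f.restrict C) '' offPeakShapes Q L)) +
      lam * volume (interior Q) ≤ exponentMeasure C F PF {g | 1 ≤ dist g 0} := by
  set D := closure ((fun f : NNCont (EuclideanSpace ℝ (Fin d)) => f.restrict C) ''
    offPeakShapes Q L)
  rw [exponentMeasure_eq_shapeIntensity hF isClosed_closure.measurableSet,
    exponentMeasure_eq_shapeIntensity hF (measurableSet_le_dist_zero 1)]
  set R : Set (ℝ × EuclideanSpace ℝ (Fin d) × ΩF) :=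
    {u | 1 ≤ u.toNNReal * lam} ×ˢ (interior Q ×ˢ univ)
  have hrect : shapeIntensity d PF R = lam * volume (interior Q) := by
    rw [shapeIntensity, Measure.prod_prod, Measure.prod_prod, frechetIntensity_level hlam,
      measure_univ, mul_one]
  have hRm : MeasurableSet R := by
    refine MeasurableSet.prod ?_ (isOpen_interior.measurableSet.prod MeasurableSet.univ)
    exact measurableSet_le measurable_const (by fun_prop)
  rw [← hrect, ← measure_inter_add_sdiff {p | shiftedShape C (p.1, p.2.1, F p.2.2) ∈
    {g : C(C, ℝ≥0) | 1 ≤ dist g 0}} hRm, add_comm]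
  refine add_le_add (measure_mono_ae ?_) (measure_mono_ae ?_)
  · filter_upwards [ae_shapeIntensity hF_max] with ⟨u, t, ω⟩ ⟨hω0, hω⟩ hp
    refine ⟨?_, hp⟩
    obtain ⟨h1, h2, -⟩ := hp
    have h1 : 1 ≤ u.toNNReal * lam := h1
    have h2 : t ∈ interior Q := h2
    have h3 := apply_le_dist_zero ((shiftedFun (u, t, F ω)).restrict C)
      ⟨t, hQC (interior_subset h2)⟩
    rw [ContinuousMap.restrict_apply, shiftedFun_self] at h3
    simp only at hω0
    rw [hω0] at h3
    exact le_trans (show (1 : ℝ) ≤ (u.toNNReal * lam : ℝ≥0) by exact_mod_cast h1) h3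
  · filter_upwards [ae_shapeIntensity hF_max] with ⟨u, t, ω⟩ ⟨hω0, hω⟩ hp
    simp only at hω0 hω
    have hp : (shiftedFun (u, t, F ω)).restrict C ∈ D := hp
    have h1 : 1 ≤ dist ((shiftedFun (u, t, F ω)).restrict C) 0 :=
      one_le_dist_of_mem_closure (A := offPeakShapes Q L) Subset.rfl
        (fun f ⟨s, hs, _, h, _⟩ => ⟨s, hC ▸ hs, h⟩) hp
    refine ⟨h1, fun hR => ?_⟩
    have hu := pos_of_one_le_dist h1
    exact notMem_interior_of_mem_closure_offPeakShapes hC hQC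
      (shiftedFun_lt hu (fun s hs => hω0 ▸ hω s hs) t) hp hR.2.1

/-- Remote points are among the exceedances on `Q`, which have finite mass by the integrability of
the running maximum of `F`. They decrease to the empty set as `L` exhausts the space, so continuity
from above applies. -/
lemma tendsto_remoteExceedances (hF : Measurable F) [CompactSpace Q] (hne : Q.Nonempty)
    (hfin : supIntegral Q F PF ≠ ∞)
    {L : ℕ → Set (EuclideanSpace ℝ (Fin d))} (hL_compact : ∀ j, IsCompact (L j))
    (hL_mono : Monotone L) (hL_union : ⋃ j, L j = univ) :
    (∀ j, shapeIntensity d PF (remoteExceedances Q (L j) F) ≠ ∞) ∧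
    Tendsto (fun j => shapeIntensity d PF (remoteExceedances Q (L j) F)) atTop (𝓝 0) := by
  have hQ : IsCompact Q := isCompact_iff_compactSpace.2 inferInstance
  have hm := continuous_shiftedShape_measurable Q hF
  have hfin' : ∀ j, shapeIntensity d PF (remoteExceedances Q (L j) F) ≠ ∞ := fun j => by
    have h1 := (isHomogeneousMeasure_exponentMeasure hF hfin).measure_ne_top one_pos
      (A := {g | 1 ≤ dist g 0}) fun g hg => hg
    rw [exponentMeasure_eq_shapeIntensity hF (measurableSet_le_dist_zero 1)] at h1
    exact ne_top_of_le_ne_top h1 (measure_mono fun p hp => hp.2)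
  refine ⟨hfin', ?_⟩
  have hmeas : ∀ j, MeasurableSet (remoteExceedances Q (L j) F) := fun j => by
    have h1 : Measurable fun p : ℝ × EuclideanSpace ℝ (Fin d) × ΩF => p.2.1 := by fun_prop
    exact (h1 (hQ.add (hL_compact j)).isClosed.measurableSet.compl).inter
      (hm (measurableSet_le_dist_zero 1))
  have hanti : Antitone fun j => remoteExceedances Q (L j) F := fun i j hij p hp =>
    ⟨fun h => hp.1 (add_subset_add_left (hL_mono hij) h), hp.2⟩
  have hempty : ⋂ j, remoteExceedances Q (L j) F = ∅ := by
    refine eq_empty_iff_forall_notMem.2 fun p hp => ?_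
    obtain ⟨q, hq⟩ := hne
    obtain ⟨j, hj⟩ := mem_iUnion.1 (hL_union ▸ mem_univ (p.2.1 - q))
    refine (mem_iInter.1 hp j).1 ?_
    simpa using add_mem_add hq hj
  have := tendsto_measure_iInter_atTop (μ := shapeIntensity d PF)
    (fun j => (hmeas j).nullMeasurableSet) hanti ⟨0, hfin' 0⟩
  rwa [hempty, measure_empty] at this

end Intensity

end M3

namespace M3

/-! ### Asymptotic bounds for the conditional probability. -/

section Conditional

variable {d : ℕ} {Ω ΩM ΩF : Type*} [MeasurableSpace Ω] [MeasurableSpace ΩM] [MeasurableSpace ΩF]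
  {P : Measure Ω} [IsProbabilityMeasure P] {PM : Measure ΩM} [IsProbabilityMeasure PM]
  {PF : Measure ΩF} [IsProbabilityMeasure PF] {η : Ω → NNCont (EuclideanSpace ℝ (Fin d))}
  {M : ΩM → NNCont (EuclideanSpace ℝ (Fin d))} {F : ΩF → NNCont (EuclideanSpace ℝ (Fin d))}
  {lam : ℝ≥0} {Q L K : Set (EuclideanSpace ℝ (Fin d))}

lemma measurable_restrict (hη : Measurable η) (C : Set (EuclideanSpace ℝ (Fin d))) :
    Measurable fun ω => (η ω).restrict C :=
  (ContinuousMap.continuous_restrict C).measurable.comp hη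

lemma measurableSet_peakEvent (hη : Measurable η) (hQ : IsCompact Q) (hL : IsCompact L)
    (hne : Q.Nonempty) (hL0 : 0 ∈ L) (a : ℝ) : MeasurableSet (peakEvent η Q L a) := by
  have := isCompact_iff_compactSpace.1 hQ
  have := isCompact_iff_compactSpace.1 (hQ.add hL)
  have hne' : (Q + L).Nonempty := hne.add ⟨0, hL0⟩
  have h1 : Measurable fun ω => dist ((η ω).restrict Q) 0 :=
    continuous_dist_zero.measurable.comp (measurable_restrict hη Q)
  have h2 : Measurable fun ω => dist ((η ω).restrict (Q + L)) 0 :=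
    continuous_dist_zero.measurable.comp (measurable_restrict hη (Q + L))
  have h3 : peakEvent η Q L a = {ω | dist ((η ω).restrict Q) 0 = dist ((η ω).restrict (Q + L)) 0} ∩
      {ω | a ≤ dist ((η ω).restrict Q) 0} := by
    ext ω
    simp only [peakEvent, mem_ofPred_eq, mem_inter_iff, ← coe_sSup_image hne,
      ← coe_sSup_image hne', NNReal.coe_inj]
  rw [h3]
  exact (measurableSet_eq_fun h1 h2).inter (measurableSet_le measurable_const h1)

lemma supIntegral_ne_top_of_isCompact (hF : Measurable F)
    (hF_sup : ∀ K : Set (EuclideanSpace ℝ (Fin d)), IsCompact K →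
      ∫⁻ t, ∫⁻ ω, ⨆ t₀ ∈ K, (F ω (t₀ - t) : ℝ≥0∞) ∂PF ∂volume < ∞)
    (C : Set (EuclideanSpace ℝ (Fin d))) [CompactSpace C] : supIntegral C F PF ≠ ∞ :=
  supIntegral_ne_top hF (hF_sup C (isCompact_iff_compactSpace.2 inferInstance))

lemma eventually_peak_inter_shape_le (hη : Measurable η) (hF : Measurable F) (hlam : 0 < lam)
    (hF_max : ∀ᵐ ω ∂PF, F ω 0 = lam ∧ ∀ t, t ≠ 0 → F ω t < lam)
    (hF_sup : ∀ K : Set (EuclideanSpace ℝ (Fin d)), IsCompact K →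
      ∫⁻ t, ∫⁻ ω, ⨆ t₀ ∈ K, (F ω (t₀ - t) : ℝ≥0∞) ∂PF ∂volume < ∞)
    (hM : IsMixedMovingMaxima M PM F PF) (hMDA : InMaxDomainOfAttraction η P M PM)
    [CompactSpace Q] (hK : IsCompact K) (hne : Q.Nonempty) (hL : IsCompact L) (hL0 : 0 ∈ L)
    (hrem : shapeIntensity d PF (remoteExceedances Q L F) ≠ ∞) (B : Set (NNCont K)) {r : ℝ}
    (hr : lam * (volume.real Q * PF.real {ω | window K (F ω) 0 lam ∈ closure B}) +
      (shapeIntensity d PF).real (remoteExceedances Q L F) < r) :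
    ∀ᶠ a : ℝ in atTop, a * P.real (peakEvent η Q L a ∩ shapeEvent η Q K B) ≤ r := by
  have hQ : IsCompact Q := isCompact_iff_compactSpace.2 inferInstance
  have := isCompact_iff_compactSpace.1 hK
  -- `Q + L` carries the peak condition, and `Q + K` contains every window centred at a point of
  -- `Q`.
  set C := Q + L ∪ (Q + K) with hC
  have hCc : IsCompact C := (hQ.add hL).union (hQ.add hK)
  have := isCompact_iff_compactSpace.1 hCc
  have hQC : Q ⊆ C := fun q hq => Or.inl (by simpa using add_mem_add hq hL0)
  obtain ⟨Y, hY⟩ := hM.exists_isPoissonSup (C := C)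
  have hfin := supIntegral_ne_top_of_isCompact hF hF_sup C
  set D := closure ((fun f : NNCont (EuclideanSpace ℝ (Fin d)) => f.restrict C) ''
    peakShapes Q L K B)
  have hle := exponentMeasure_peakShapes_le hF hlam hF_max hne hQC subset_union_left
    subset_union_right B (PF := PF) (L := L)
  refine eventually_mul_real_le (measurable_restrict hη C)
    (isHomogeneousMeasure_exponentMeasure hF hfin) hY (hMDA.tendsto_restrict C)
    (D := D) isClosed_closure ?_ (lt_of_le_of_lt ?_ hr) ?_
  · refine fun g hg => closure_minimal (t := {g | 1 ≤ dist g 0}) ?_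
      (isClosed_le continuous_const continuous_dist_zero) hg
    rintro _ ⟨f, hf, rfl⟩
    have h1 : (1 : ℝ) ≤ f (tau Q f) := hf.2.1
    exact h1.trans (apply_le_dist_zero (f.restrict C) ⟨_, hQC (tau_mem_argmaxOn hQ hne f).1⟩)
  · have h2 := ENNReal.toReal_mono (by have := hQ.measure_ne_top (μ := volume); finiteness) hle
    rw [ENNReal.toReal_add (by have := hQ.measure_ne_top (μ := volume); finiteness) hrem,
      ENNReal.toReal_mul, ENNReal.toReal_mul] at h2
    exact h2
  · intro a b hb hba ω hω
    exact subset_closure ⟨_, smul_mem_peakShapes hQ hL hne hb hba hω, rfl⟩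

/-- The total tail over `Q + L` is bounded below and its off-peak part above; subtracting them makes
a lower bound for general open sets unnecessary. -/
lemma eventually_le_peak (hη : Measurable η) (hF : Measurable F) (hlam : 0 < lam)
    (hF_max : ∀ᵐ ω ∂PF, F ω 0 = lam ∧ ∀ t, t ≠ 0 → F ω t < lam)
    (hF_sup : ∀ K : Set (EuclideanSpace ℝ (Fin d)), IsCompact K →
      ∫⁻ t, ∫⁻ ω, ⨆ t₀ ∈ K, (F ω (t₀ - t) : ℝ≥0∞) ∂PF ∂volume < ∞)
    (hM : IsMixedMovingMaxima M PM F PF) (hMDA : InMaxDomainOfAttraction η P M PM)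
    (hQ : IsCompact Q) (hne : Q.Nonempty) (hL : IsCompact L) (hL0 : 0 ∈ L) {r : ℝ}
    (hr : r < lam * volume.real (interior Q)) :
    ∀ᶠ a : ℝ in atTop, r ≤ a * P.real (peakEvent η Q L a) := by
  set C := Q + L with hC
  have hCc : IsCompact C := hQ.add hL
  have := isCompact_iff_compactSpace.1 hCc
  have hQC : Q ⊆ C := fun q hq => by simpa using add_mem_add hq hL0
  obtain ⟨Y, hY⟩ := hM.exists_isPoissonSup (C := C)
  have hfin := supIntegral_ne_top_of_isCompact hF hF_sup C
  have hμ := isHomogeneousMeasure_exponentMeasure hF hfin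
  set μ := exponentMeasure C F PF
  set c := (supIntegral C F PF).toReal
  set D := closure ((fun f : NNCont (EuclideanSpace ℝ (Fin d)) => f.restrict C) ''
    offPeakShapes Q L)
  have hD1 : ∀ g ∈ D, 1 ≤ dist g 0 := by
    refine fun g hg => closure_minimal (t := {g | 1 ≤ dist g 0}) ?_
      (isClosed_le continuous_const continuous_dist_zero) hg
    rintro _ ⟨f, ⟨s, hs, -, h1, -⟩, rfl⟩
    have h1 : (1 : ℝ) ≤ f s := h1
    exact h1.trans (apply_le_dist_zero (f.restrict C) ⟨_, hs⟩)
  have hvol : volume (interior Q) ≠ ∞ :=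
    ne_top_of_le_ne_top hQ.measure_ne_top (measure_mono interior_subset)
  have hDc : μ.real D + lam * volume.real (interior Q) ≤ c := by
    have h1 := ENNReal.toReal_mono (hμ.measure_ne_top one_pos fun g hg => hg)
      (exponentMeasure_offPeakShapes_add_le hF hlam hF_max hC hQC)
    rw [ENNReal.toReal_add (hμ.measure_ne_top one_pos hD1) (by finiteness),
      ENNReal.toReal_mul] at h1
    have h2 := hμ.real_le_dist one_pos
    rw [div_one] at h2
    exact h1.trans h2.le
  set δ := (lam * volume.real (interior Q) - r) / 2 with hδ
  have hδ0 : 0 < δ := by rw [hδ]; linarith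
  have hup := eventually_mul_real_le (measurable_restrict hη C) hμ hY (hMDA.tendsto_restrict C)
    (D := D) isClosed_closure hD1 (r := μ.real D + δ) (by linarith)
    (S := fun a => {ω | a ≤ (sSup (η ω '' C) : ℝ≥0)} \ peakEvent η Q L a)
    (fun a b hb hba ω hω =>
      subset_closure ⟨_, smul_mem_offPeakShapes hQ hL hne hL0 hb hba hω.1 hω.2, rfl⟩)
  have hlow := eventually_le_mul_real (measurable_restrict hη C) hμ hY (hMDA.tendsto_restrict C)
    (r := c - δ) (by linarith)
  filter_upwards [hup, hlow, eventually_ge_atTop 0] with a h1 h2 ha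
  have h3 : P.real {ω | a ≤ dist ((η ω).restrict C) 0} ≤ P.real (peakEvent η Q L a) +
      P.real ({ω | a ≤ (sSup (η ω '' C) : ℝ≥0)} \ peakEvent η Q L a) := by
    simp only [coe_sSup_image (hne.mono hQC)]
    refine (measureReal_mono fun ω hω => ?_).trans (measureReal_union_le _ _)
    by_cases h : ω ∈ peakEvent η Q L a
    · exact Or.inl h
    · exact Or.inr ⟨hω, h⟩
  have h4 := mul_le_mul_of_nonneg_left h3 ha
  rw [mul_add] at h4
  linarith

/-- An asymptotic upper bound for the conditional probability of a shape given a peak. -/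
lemma eventually_cond_le (hη : Measurable η) (hF : Measurable F) (hlam : 0 < lam)
    (hF_max : ∀ᵐ ω ∂PF, F ω 0 = lam ∧ ∀ t, t ≠ 0 → F ω t < lam)
    (hF_sup : ∀ K : Set (EuclideanSpace ℝ (Fin d)), IsCompact K →
      ∫⁻ t, ∫⁻ ω, ⨆ t₀ ∈ K, (F ω (t₀ - t) : ℝ≥0∞) ∂PF ∂volume < ∞)
    (hM : IsMixedMovingMaxima M PM F PF) (hMDA : InMaxDomainOfAttraction η P M PM)
    [CompactSpace Q] (hK : IsCompact K) (hQ_frontier : volume (frontier Q) = 0)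
    (hQ_pos : 0 < volume Q) (hL : IsCompact L) (hL0 : 0 ∈ L)
    (hrem : shapeIntensity d PF (remoteExceedances Q L F) ≠ ∞) (B : Set (NNCont K)) {r : ℝ}
    (hr : PF.real {ω | window K (F ω) 0 lam ∈ closure B} +
      (shapeIntensity d PF).real (remoteExceedances Q L F) / (lam * volume.real Q) < r) :
    ∀ᶠ a : ℝ in atTop, 0 < P (peakEvent η Q L a) ∧
      cond P (peakEvent η Q L a) (shapeEvent η Q K B) ≤ ENNReal.ofReal r := by
  have hQ : IsCompact Q := isCompact_iff_compactSpace.2 inferInstance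
  have hne : Q.Nonempty := nonempty_of_measure_ne_zero hQ_pos.ne'
  have hV : 0 < volume.real Q := ENNReal.toReal_pos hQ_pos.ne' hQ.measure_ne_top
  have hint : volume.real (interior Q) = volume.real Q := by
    rw [measureReal_def, measureReal_def]
    congr 1
    exact measure_congr (interior_ae_eq_of_null_frontier hQ_frontier)
  have hlamV : 0 < lam * volume.real Q := mul_pos hlam hV
  set p := PF.real {ω | window K (F ω) 0 lam ∈ closure B}
  set β := (shapeIntensity d PF).real (remoteExceedances Q L F)
  set V := lam * volume.real Q with hVdef
  have hr0 : 0 < r := lt_of_le_of_lt (by positivity) hr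
  have hr' : p * V + β < r * V := by
    have := mul_lt_mul_of_pos_right hr hlamV
    rwa [add_mul, div_mul_cancel₀ _ hlamV.ne'] at this
  obtain ⟨s, hs1, hs2⟩ := exists_between hr'
  have hsV : s / r < V := by
    rw [div_lt_iff₀ hr0]
    linarith
  -- `w` bounds the peak mass below: `w < V` makes it admissible, `s / r < w` yields the quotient
  -- bound `r`, and `0 < w` makes the conditioning event non-null.
  obtain ⟨w, hw1, hw2⟩ := exists_between (max_lt hsV hlamV)
  have hsw : s ≤ r * w := by
    have := (max_lt_iff.1 hw1).1
    rw [div_lt_iff₀ hr0] at this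
    linarith
  have hw0 : 0 < w := (max_lt_iff.1 hw1).2
  have hup := eventually_peak_inter_shape_le hη hF hlam hF_max hF_sup hM hMDA hK hne hL hL0 hrem B
    (r := s) (by
      rw [← mul_assoc, ← hVdef]
      linarith)
  have hlow := eventually_le_peak hη hF hlam hF_max hF_sup hM hMDA hQ hne hL hL0 (r := w)
    (by rwa [hint])
  filter_upwards [hup, hlow, eventually_gt_atTop 0] with a h1 h2 ha
  have hpos : 0 < P.real (peakEvent η Q L a) := by
    by_contra hneg
    nlinarith [mul_nonpos_of_nonneg_of_nonpos ha.le (not_lt.1 hneg)]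
  have hpos' : 0 < P (peakEvent η Q L a) := (ENNReal.toReal_pos_iff.1 hpos).1
  refine ⟨hpos', ?_⟩
  have hineq : P.real (peakEvent η Q L a ∩ shapeEvent η Q K B) ≤
      r * P.real (peakEvent η Q L a) := by
    have h3 : a * P.real (peakEvent η Q L a ∩ shapeEvent η Q K B) ≤
        a * (r * P.real (peakEvent η Q L a)) :=
      calc _ ≤ s := h1
        _ ≤ r * w := hsw
        _ ≤ r * (a * P.real (peakEvent η Q L a)) := by gcongr
        _ = _ := by ring
    exact le_of_mul_le_mul_left h3 ha
  rw [cond_apply (measurableSet_peakEvent hη hQ hL hne hL0 a), mul_comm, ← div_eq_mul_inv]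
  refine ENNReal.div_le_of_le_mul ?_
  rw [← ofReal_measureReal (s := peakEvent η Q L a ∩ shapeEvent η Q K B),
    ← ofReal_measureReal (s := peakEvent η Q L a), ← ENNReal.ofReal_mul hr0.le]
  exact ENNReal.ofReal_le_ofReal hineq

end Conditional

end M3

/-! ### The limit theorem: squeezing between the bounds for `B` and for its complement. -/

theorem mainTheorem3 {d : ℕ} {Ω ΩM ΩF : Type*}
    [MeasurableSpace Ω] [MeasurableSpace ΩM] [MeasurableSpace ΩF]
    (P : Measure Ω) [IsProbabilityMeasure P]
    (PM : Measure ΩM) [IsProbabilityMeasure PM]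
    (PF : Measure ΩF) [IsProbabilityMeasure PF]
    (η : Ω → NNCont (EuclideanSpace ℝ (Fin d)))
    (M : ΩM → NNCont (EuclideanSpace ℝ (Fin d)))
    (F : ΩF → NNCont (EuclideanSpace ℝ (Fin d)))
    (hη : Measurable η) (hF : Measurable F)
    (hη_pos : ∀ᵐ ω ∂P, ∀ t, 0 < η ω t)
    (hF_int : ∫⁻ ω, ∫⁻ t, (F ω t : ℝ≥0∞) ∂volume ∂PF = 1)
    (lam : ℝ≥0) (hlam : 0 < lam)
    (hF_max : ∀ᵐ ω ∂PF, F ω 0 = lam ∧ ∀ t, t ≠ 0 → F ω t < lam)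
    (hF_sup : ∀ K : Set (EuclideanSpace ℝ (Fin d)), IsCompact K →
      ∫⁻ t, ∫⁻ ω, ⨆ t₀ ∈ K, (F ω (t₀ - t) : ℝ≥0∞) ∂PF ∂volume < ∞)
    (hM : M3.IsMixedMovingMaxima M PM F PF)
    (hMDA : M3.InMaxDomainOfAttraction η P M PM)
    (Q K : Set (EuclideanSpace ℝ (Fin d))) (hQ : IsCompact Q) (hK : IsCompact K)
    (hQ_frontier : volume (frontier Q) = 0) (hQ_pos : 0 < volume Q)
    (B : Set (NNCont K)) (hB : MeasurableSet B)
    (hB_frontier : PF {ω | M3.window K (F ω) 0 lam ∈ frontier B} = 0)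
    (a : ℕ → ℝ) (ha : Tendsto a atTop atTop)
    (L : ℕ → Set (EuclideanSpace ℝ (Fin d))) (hL_compact : ∀ j, IsCompact (L j))
    (hL_zero : ∀ j, 0 ∈ L j) (hL_mono : Monotone L) (hL_union : ⋃ j, L j = univ) :
    Tendsto
      (fun j => limsup
        (fun n => cond P (M3.peakEvent η Q (L j) (a n)) (M3.shapeEvent η Q K B)) atTop)
      atTop (𝓝 (PF {ω | M3.window K (F ω) 0 lam ∈ B})) ∧
    Tendsto
      (fun j => liminf
        (fun n => cond P (M3.peakEvent η Q (L j) (a n)) (M3.shapeEvent η Q K B)) atTop)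
      atTop (𝓝 (PF {ω | M3.window K (F ω) 0 lam ∈ B})) := by

  have hQ' := isCompact_iff_compactSpace.1 hQ
  have hne : Q.Nonempty := nonempty_of_measure_ne_zero hQ_pos.ne'
  have hm : Measurable fun ω => M3.window K (F ω) 0 lam := by
    have : Measurable fun f : NNCont (EuclideanSpace ℝ (Fin d)) => M3.window K f 0 lam := by
      refine Continuous.measurable (ContinuousMap.continuous_of_continuous_uncurry _ ?_)
      change Continuous fun q : NNCont (EuclideanSpace ℝ (Fin d)) × K =>
        q.1 ((0 : EuclideanSpace ℝ (Fin d)) + q.2) / lam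
      have h : Continuous fun q : NNCont (EuclideanSpace ℝ (Fin d)) × K =>
          q.1 ((0 : EuclideanSpace ℝ (Fin d)) + q.2) :=
        ContinuousEval.continuous_eval.comp (f := fun q : NNCont (EuclideanSpace ℝ (Fin d)) × K =>
          (q.1, (0 : EuclideanSpace ℝ (Fin d)) + q.2)) (by fun_prop)
      exact h.div_const _
    exact this.comp hF
  obtain ⟨hrem, hlim⟩ := M3.tendsto_remoteExceedances hF hne
    (M3.supIntegral_ne_top_of_isCompact hF hF_sup Q) hL_compact hL_mono hL_union
  set p := PF.real {ω | M3.window K (F ω) 0 lam ∈ B} with hp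
  have hcl : PF.real {ω | M3.window K (F ω) 0 lam ∈ closure B} = p := by
    refine congrArg ENNReal.toReal (measure_congr ?_)
    filter_upwards [measure_eq_zero_iff_ae_notMem.1 hB_frontier] with ω hω
    have hω : M3.window K (F ω) 0 lam ∉ frontier B := hω
    refine propext ⟨fun h => ?_, fun h => subset_closure h⟩
    have h : M3.window K (F ω) 0 lam ∈ closure B := h
    rw [closure_eq_self_union_frontier] at h
    exact h.resolve_right hω
  have hcl' : PF.real {ω | M3.window K (F ω) 0 lam ∈ closure Bᶜ} = 1 - p := by
    have hBm : MeasurableSet {ω | M3.window K (F ω) 0 lam ∈ B} := hm hB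
    rw [hp, ← probReal_compl_eq_one_sub hBm]
    refine congrArg ENNReal.toReal (measure_congr ?_)
    filter_upwards [measure_eq_zero_iff_ae_notMem.1 hB_frontier] with ω hω
    have hω : M3.window K (F ω) 0 lam ∉ frontier B := hω
    refine propext ⟨fun h => ?_, fun h => subset_closure h⟩
    have h : M3.window K (F ω) 0 lam ∈ closure Bᶜ := h
    rw [closure_eq_self_union_frontier, frontier_compl] at h
    exact h.resolve_right hω
  set V := lam * volume.real Q
  set u : ℕ → ℝ := fun j =>
    (M3.shapeIntensity d PF).real (M3.remoteExceedances Q (L j) F) / V with hu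
  have hu0 : Tendsto u atTop (𝓝 0) := by
    simpa [hu, measureReal_def, Function.comp_def] using
      ((ENNReal.tendsto_toReal ENNReal.zero_ne_top).comp hlim).div_const V
  set κ : ℕ → ℕ → ℝ≥0∞ := fun j n =>
    cond P (M3.peakEvent η Q (L j) (a n)) (M3.shapeEvent η Q K B)
  have hup : ∀ j, limsup (κ j) atTop ≤ ENNReal.ofReal (p + u j) := by
    intro j
    have h1 : Tendsto (fun ε : ℝ => ENNReal.ofReal (p + u j + ε)) (𝓝[>] 0)
        (𝓝 (ENNReal.ofReal (p + u j))) := by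
      refine ((ENNReal.continuous_ofReal.comp (continuous_const_add (p + u j))).tendsto' 0 _
        (by simp)).mono_left nhdsWithin_le_nhds
    refine ge_of_tendsto h1 (eventually_mem_nhdsWithin.mono fun ε hε => ?_)
    have hε : 0 < ε := hε
    refine limsup_le_of_le (by isBoundedDefault) ?_
    exact (ha.eventually (M3.eventually_cond_le hη hF hlam hF_max hF_sup hM hMDA hK hQ_frontier
      hQ_pos (hL_compact j) (hL_zero j) (hrem j) B (r := p + u j + ε)
      (by rw [hcl]; exact lt_add_of_pos_right _ hε))).mono fun n hn => hn.2
  have hlow : ∀ j, ENNReal.ofReal (p - u j) ≤ liminf (κ j) atTop := by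
    intro j
    have h1 : Tendsto (fun ε : ℝ => ENNReal.ofReal (p - u j - ε)) (𝓝[>] 0)
        (𝓝 (ENNReal.ofReal (p - u j))) := by
      refine ((ENNReal.continuous_ofReal.comp (continuous_const.sub continuous_id)).tendsto' 0 _
        (by simp)).mono_left nhdsWithin_le_nhds
    refine le_of_tendsto h1 (eventually_mem_nhdsWithin.mono fun ε hε => ?_)
    have hε : 0 < ε := hε
    refine le_liminf_of_le (by isBoundedDefault) ?_
    filter_upwards [ha.eventually (M3.eventually_cond_le hη hF hlam hF_max hF_sup hM hMDA hK
      hQ_frontier hQ_pos (hL_compact j) (hL_zero j) (hrem j) Bᶜ (r := 1 - p + u j + ε)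
      (by rw [hcl']; exact lt_add_of_pos_right _ hε))] with n hn
    have := cond_isProbabilityMeasure (μ := P) hn.1.ne'
    -- Subadditivity over this cover turns the upper bound for `Bᶜ` into a lower bound for `B`
    -- without using measurability of the shape event.
    have hcover : (univ : Set Ω) ⊆ M3.shapeEvent η Q K B ∪ M3.shapeEvent η Q K Bᶜ :=
      fun ω _ => em (M3.window K (η ω) (M3.tau Q (η ω)) (η ω (M3.tau Q (η ω))) ∈ B)
    have h2 : 1 ≤ κ j n + ENNReal.ofReal (1 - p + u j + ε) :=
      calc (1 : ℝ≥0∞) = cond P (M3.peakEvent η Q (L j) (a n)) univ := measure_univ.symm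
        _ ≤ _ := (measure_mono hcover).trans (measure_union_le _ _)
        _ ≤ _ := by gcongr; exact hn.2
    have h3 : ENNReal.ofReal (p - u j - ε) = 1 - ENNReal.ofReal (1 - p + u j + ε) := by
      have hp1 : p ≤ 1 := measureReal_le_one
      have huj : 0 ≤ u j := by positivity
      rw [← ENNReal.ofReal_one, ← ENNReal.ofReal_sub _ (by linarith)]
      congr 1
      ring
    rw [h3]
    exact tsub_le_iff_right.2 h2
  have hmid : ∀ j, liminf (κ j) atTop ≤ limsup (κ j) atTop := fun j =>
    liminf_le_limsup (by isBoundedDefault) (by isBoundedDefault)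
  have hpP : PF {ω | M3.window K (F ω) 0 lam ∈ B} = ENNReal.ofReal p :=
    (ofReal_measureReal (measure_ne_top PF _)).symm
  have hu1 : Tendsto (fun j => ENNReal.ofReal (p + u j)) atTop (𝓝 (ENNReal.ofReal p)) := by
    simpa using ENNReal.tendsto_ofReal (hu0.const_add p)
  have hu2 : Tendsto (fun j => ENNReal.ofReal (p - u j)) atTop (𝓝 (ENNReal.ofReal p)) := by
    simpa using ENNReal.tendsto_ofReal (hu0.const_sub p)
  rw [hpP]
  exact ⟨tendsto_of_tendsto_of_tendsto_of_le_of_le hu2 hu1 (fun j => (hlow j).trans (hmid j)) hup,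
    tendsto_of_tendsto_of_tendsto_of_le_of_le hu2 hu1 hlow fun j => (hmid j).trans (hup j)⟩
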